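/- **Setting.** Let $\mathcal G=(V,\mathcal B,E)$ be a Borel graph: $(V,\mathcal B)$ is a standard Borel space and $E$ is a Borel set of unordered pairs of distinct points of $V$. Assume that the maximum degree $\Delta$ of $\mathcal G$ is finite. The line graph $\mathcal E$ has vertex set $E$ (with the inherited $\sigma$-algebra); two different edges are adjacent when they share a vertex. Let $F_{\mathcal E}$ be its connectedness relation. Let $\nu$ be a Borel probability measure on $E$ that is $\mathcal E$-quasi-invariant (the union of the connected components of $\mathcal E$ meeting a null set is null). Fix a Radon–Nikodym cocycle $\rho_\nu$ of $\nu$ with respect to $\mathcal E$: a Borel function $\rho_\nu:F_{\mathcal E}\to(0,\infty)$ with $\nu(g(C))=\int_C\rho_\nu(e,g(e))\,d\nu(e)$ for every Borel $C\subseteq E$ and every injective Borel $g:C\to E$ with $(e,g(e))\in F_{\mathcal E}$ for all $e\in C$. A *partial coloring* is a partial Borel map $c$ from $E$ to $[\Delta+1]=\{1,\dots,\Delta+1\}$ giving different colors to different edges of its domain that share a vertex; $U_c=E\setminus\operatorname{dom}(c)$, and $m_c(x)$ is the set of colors not used by $c$ on the edges at $x\in V$. **Chains.** A *chain* is a finite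 (possibly empty) or infinite sequence $P=(e_0,e_1,\dots)$ of edges in which consecutive edges intersect; $P\sqsubseteq Q$ means that $P$ is a prefix of $Q$, and ${}^\frown$ is concatenation. $P$ is *$c$-augmenting* if * it is nonempty and without repeated edges, $e_0\in U_c$, and all other edges are in $\operatorname{dom}(c)$; * the shift $c_P$ is a partial coloring, where $c_P(e_i)=c(e_{i+1})$ for each $i$ for which $e_{i+1}$ exists, the last edge (if any) is uncolored, and $c_P=c$ off $P$; * $P$ is infinite, or $m_{c_P}(x)\cap m_{c_P}(y)\neq\emptyset$ where $x\ne y$ are the vertices of its last edge. *Alternating path.* For colors $\alpha\ne\beta$ with $\beta\in m_c(x)$, $P_c(x,\alpha/\beta)$ is the maximal chain without repeated edges whose first edge (if any) contains $x$, whose second edge (if any) does not, and whose edges are colored alternately $\alpha,\beta,\alpha,\dots$. *Fan.* For $x\in e\in U_c$, $F_c(x,e)$ is the maximal sequence of distinct edges $e_i=\{x,v_i\}$ with $e_0=e$ and $c(e_{i+1})=\min m_c(v_i)$ whenever $e_{i+1}$ is in the sequence. *Conditional fan.* Let $f$ be an edge of $P_c(z,\alpha/\beta)$ that is neither its first nor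 its last edge, and let $y$ be the last vertex of the prefix of $P_c(z,\alpha/\beta)$ ending with $f$. Then $F_c(z,\alpha/\beta,y)$ is the maximal sequence of distinct edges $g_i=\{y,u_i\}$ with $g_0=f$ such that, whenever $g_{i+1}$ is in the sequence, $c(g_{i+1})=\min m_c(u_i)$ and $\alpha,\beta\notin m_c(u_i)$. *3-step Vizing chain.* For $e\in U_c$, a $3$-step Vizing chain at $e$ is a $c$-augmenting chain of the form $$W=F^1{}^\frown P^1{}^\frown F^2{}^\frown P^2{}^\frown F^3{}^\frown P^3$$ for which there are vertices $y_i,z_i$ and colors $\alpha_i,\beta_i$ ($i=1,2,3$) such that $y_1\in e$, $F^1\sqsubseteq F_c(y_1,e)$, $F^2\sqsubseteq F_c(z_1,\alpha_1/\beta_1,y_2)$, $F^3\sqsubseteq F_c(z_2,\alpha_2/\beta_2,y_3)$, $P^i\sqsubseteq P_c(z_i,\alpha_i/\beta_i)$ for $i=1,2,3$, all pieces to the right of an empty piece are empty, and $y_1,y_2,y_3,z_1,z_2,z_3$ are pairwise different. Here an empty piece imposes no condition on its own vertex ($y_i$ for $F^i$, $z_i$ for $P^i$). A partial coloring $c$ *does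 not admit an improvement of weight $L\in\mathbb N$* if $$\nu\Big(\Big\{e\in U_c:\ \text{there is a 3-step Vizing chain } W \text{ at } e \text{ with } \sum_{f\in W}\rho_\nu(e,f)\le L\Big\}\Big)=0 .$$ **Theorem.** Let $c$ be a partial coloring and $L\in\mathbb N$. Then there is a partial coloring $c'$ that does not admit an improvement of weight $L$ and satisfies $\nu(\operatorname{dom}(c)\setminus\operatorname{dom}(c'))=0$ and $$\nu(\{e\in E: c(e)\ne c'(e)\})\le L\,\nu(U_c),$$ where $c(e)\neq c'(e)$ includes the case that exactly one of $c(e)$, $c'(e)$ is defined. -/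

import Mathlib

open MeasureTheory
open scoped ENNReal

namespace BorelVizing

section Cocycle

variable {X : Type*} [MeasurableSpace X]

/-- `μ` is quasi-invariant for the connectedness relation of the graph `H`: the saturation of a
null set, i.e. the union of the connected components which meet it, is null. -/
def QuasiInvariant (H : SimpleGraph X) (μ : Measure X) : Prop :=
  ∀ A : Set X, MeasurableSet A → μ A = 0 → μ {x | ∃ a ∈ A, H.Reachable a x} = 0

/-- `ρ` is a Radon-Nikodym cocycle of `μ` with respect to the connectedness relation
`F = {(x, y) | H.Reachable x y}`: a Borel function from `F` to the positive reals (the values of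
`ρ` off `F` are irrelevant) such that `μ (g '' C) = ∫ x in C, ρ x (g x) ∂μ` for every Borel
injection `g : C → X` whose graph is contained in `F`. -/
structure IsRadonNikodymCocycle (H : SimpleGraph X) (μ : Measure X) (ρ : X → X → ℝ) : Prop where
  measurable : Measurable fun p : {p : X × X // H.Reachable p.1 p.2} => ρ p.1.1 p.1.2
  pos : ∀ x y, H.Reachable x y → 0 < ρ x y
  measure_image : ∀ (C : Set X) (g : X → X), MeasurableSet C → (Measurable fun x : C => g x) →
    Set.InjOn g C → (∀ x ∈ C, H.Reachable x (g x)) →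
      μ (g '' C) = ∫⁻ x in C, ENNReal.ofReal (ρ x (g x)) ∂μ

end Cocycle

section Coloring

variable {V : Type*} {G : SimpleGraph V} {n : ℕ}

/-- `Δ` is the maximum degree of `G`, the least uniform upper bound on the degrees. -/
def IsMaxDegree (G : SimpleGraph V) (Δ : ℕ) : Prop :=
  IsLeast {d : ℕ | ∀ x, (G.neighborSet x).encard ≤ d} Δ

/-- A partial map `c` from the edges of `G` to `n` colors (`none` means uncolored) is proper if
different edges that share a vertex never have the same color. -/
def IsProper (c : G.edgeSet → Option (Fin n)) : Prop :=
  ∀ e f : G.edgeSet, e ≠ f → (∃ x, x ∈ e.1 ∧ x ∈ f.1) → ∀ a, c e = some a → c f ≠ some a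

/-- A partial Borel proper edge coloring. The `σ`-algebra on the edge set is the one inherited
from the quotient `Sym2 V` of `V × V`. Measurability of all the color classes includes that of
the domain, their finite union. -/
structure IsPartialColoring [MeasurableSpace V] (c : G.edgeSet → Option (Fin n)) : Prop where
  measurableSet_color : ∀ a, MeasurableSet {e | c e = some a}
  proper : IsProper c

/-- The set of edges not colored by `c`. -/
def uncolored (c : G.edgeSet → Option (Fin n)) : Set G.edgeSet := {e | c e = none}

/-- The set of colors missing at the vertex `x`. -/
def missing (c : G.edgeSet → Option (Fin n)) (x : V) : Set (Fin n) :=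
  {a | ∀ e : G.edgeSet, x ∈ e.1 → c e ≠ some a}

/-- Finite (possibly empty) or infinite sequences of edges; `P.get? i` is the edge with index `i`,
counted from `0`, or `none` if the length of `P` is at most `i`. -/
abbrev EdgeSeq (G : SimpleGraph V) := Stream'.Seq G.edgeSet

/-- A chain: every two consecutive edges intersect. -/
def IsChain (P : EdgeSeq G) : Prop :=
  ∀ i e f, P.get? i = some e → P.get? (i + 1) = some f → ∃ x, x ∈ e.1 ∧ x ∈ f.1

/-- No edge is repeated. -/
def EdgeInjective (P : EdgeSeq G) : Prop :=
  ∀ i j e, P.get? i = some e → P.get? j = some e → i = j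

/-- `P` is a prefix of `Q`. -/
def IsPrefix (P Q : EdgeSeq G) : Prop :=
  ∀ i e, P.get? i = some e → Q.get? i = some e

/-- A chain is `c`-shiftable if it is nonempty and edge injective, and its first edge is its only
uncolored edge. -/
structure IsShiftable (c : G.edgeSet → Option (Fin n)) (P : EdgeSeq G) : Prop where
  chain : IsChain P
  injective : EdgeInjective P
  head_uncolored : ∃ e, P.get? 0 = some e ∧ c e = none
  tail_colored : ∀ i e, P.get? (i + 1) = some e → c e ≠ none

open Classical in
/-- The shift of `c` along an edge injective chain `P`: the edge with index `i` gets the color of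
the edge with index `i + 1`, the last edge (if there is one) becomes uncolored, and the edges
outside `P` keep their color. -/
noncomputable def shift (c : G.edgeSet → Option (Fin n)) (P : EdgeSeq G) :
    G.edgeSet → Option (Fin n) := fun f =>
  if h : ∃ i, P.get? i = some f then (P.get? (Nat.find h + 1)).bind c else c f

/-- A chain is `c`-proper-shiftable if it is `c`-shiftable and the shift is a partial coloring.
(For a Borel coloring `c` of a standard Borel graph the shift is automatically Borel, since it
differs from `c` on countably many edges only.) -/
structure IsProperShiftable (c : G.edgeSet → Option (Fin n)) (P : EdgeSeq G) : Prop where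
  shiftable : IsShiftable c P
  proper : IsProper (shift c P)

/-- A chain is `c`-augmenting if it is `c`-proper-shiftable and either infinite, or finite and such
that after the shift some color is missing at both vertices of its last edge. -/
structure IsAugmenting (c : G.edgeSet → Option (Fin n)) (P : EdgeSeq G) : Prop where
  properShiftable : IsProperShiftable c P
  last : ∀ i e, P.get? i = some e → P.get? (i + 1) = none →
    ∃ a, ∀ x ∈ e.1, a ∈ missing (shift c P) x

/-- `P` is an edge injective chain which starts at `x` and whose colors alternate between `α` and
`β`, beginning with `α`. -/
structure IsAlternating (c : G.edgeSet → Option (Fin n)) (x : V) (α β : Fin n)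
    (P : EdgeSeq G) : Prop where
  chain : IsChain P
  injective : EdgeInjective P
  start : ∀ e, P.get? 0 = some e → x ∈ e.1
  leave : ∀ e, P.get? 1 = some e → x ∉ e.1
  color : ∀ i e, P.get? i = some e → c e = some (if Even i then α else β)

/-- `P` is the alternating `α/β`-path starting at `x`, the maximal alternating chain; this notion
presupposes that `α ≠ β` and that `β` is missing at `x`. -/
structure IsAlternatingPath (c : G.edgeSet → Option (Fin n)) (x : V) (α β : Fin n)
    (P : EdgeSeq G) : Prop where
  ne : α ≠ β
  missing_start : β ∈ missing c x
  alternating : IsAlternating c x α β P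
  maximal : ∀ P', IsAlternating c x α β P' → IsPrefix P P' → P' = P

/-- `y` is the last vertex of the nonempty prefix consisting of the first `k` edges of the path `P`
which starts at `x`: it differs from `x` and lies on exactly one of these edges. -/
def IsLastVertex (x : V) (P : EdgeSeq G) (k : ℕ) (y : V) : Prop :=
  y ≠ x ∧ ∃! i, i < k ∧ ∃ e, P.get? i = some e ∧ y ∈ e.1

/-- `S` is a fan around `x` starting at `e` and stopped by the colors in `A`: an edge injective
sequence of edges `e₀ = e, e₁, …` with `eᵢ = {x, vᵢ}` such that whenever `eᵢ₊₁` is present, its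
color is the least color missing at `vᵢ`, and no color in `A` is missing at `vᵢ`. -/
structure IsFan (c : G.edgeSet → Option (Fin n)) (x : V) (e : G.edgeSet) (A : Set (Fin n))
    (S : EdgeSeq G) : Prop where
  head : S.get? 0 = some e
  injective : EdgeInjective S
  center : ∀ i f, S.get? i = some f → x ∈ f.1
  step : ∀ i f g, S.get? i = some f → S.get? (i + 1) = some g →
    ∃ v, f.1 = s(x, v) ∧ (∃ a, c g = some a ∧ IsLeast (missing c v) a) ∧
      ∀ a ∈ A, a ∉ missing c v

/-- `S` is the maximal fan around `x` starting at `e` and stopped by the colors in `A`. For `A = ∅`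
this is the maximal fan around `x` starting at `e`. -/
structure IsMaximalFan (c : G.edgeSet → Option (Fin n)) (x : V) (e : G.edgeSet) (A : Set (Fin n))
    (S : EdgeSeq G) : Prop where
  fan : IsFan c x e A S
  maximal : ∀ S', IsFan c x e A S' → IsPrefix S S' → S' = S

/-- `S` is the maximal `α/β`-conditional fan attached to the vertex `y` of the alternating
`α/β`-path `Q` starting at `z`: it starts at the edge `f` of `Q`, neither the first nor the last
edge of `Q`, for which `y` is the last vertex of the prefix of `Q` ending with `f`. It is built
like a maximal fan around `y`, except that it stops as soon as `α` or `β` is missing at the other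
vertex of its current edge. -/
def IsConditionalFan (c : G.edgeSet → Option (Fin n)) (z : V) (α β : Fin n) (y : V)
    (S : EdgeSeq G) : Prop :=
  ∃ (Q : EdgeSeq G) (j : ℕ) (f : G.edgeSet), IsAlternatingPath c z α β Q ∧
    0 < j ∧ Q.get? j = some f ∧ Q.get? (j + 1) ≠ none ∧
    IsLastVertex z Q (j + 1) y ∧ IsMaximalFan c y f {α, β} S

/-- `W` is a 3-step Vizing chain at `e`: a `c`-augmenting chain of the form
`F₁ ⌢ P₁ ⌢ F₂ ⌢ P₂ ⌢ F₃ ⌢ P₃`, where the `Fᵢ` are prefixes of (conditional) fans around `yᵢ`, the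
`Pᵢ` are prefixes of alternating paths starting at `zᵢ`, all pieces after an empty piece are
empty, and the vertices `yᵢ`, `zᵢ` are pairwise different. An empty piece imposes no condition
on the vertex that belongs to it. (If a piece is infinite, then `append` discards what follows.) -/
structure IsThreeStepVizingChain (c : G.edgeSet → Option (Fin n)) (e : G.edgeSet)
    (W : EdgeSeq G) : Prop where
  augmenting : IsAugmenting c W
  decomposition : ∃ (F₁ P₁ F₂ P₂ F₃ P₃ : EdgeSeq G) (y₁ z₁ y₂ z₂ y₃ z₃ : V)
      (α₁ β₁ α₂ β₂ α₃ β₃ : Fin n),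
    W = F₁.append (P₁.append (F₂.append (P₂.append (F₃.append P₃)))) ∧
    (F₁ ≠ .nil → y₁ ∈ e.1 ∧ ∃ M, IsMaximalFan c y₁ e ∅ M ∧ IsPrefix F₁ M) ∧
    (P₁ ≠ .nil → ∃ M, IsAlternatingPath c z₁ α₁ β₁ M ∧ IsPrefix P₁ M) ∧
    (F₂ ≠ .nil → ∃ M, IsConditionalFan c z₁ α₁ β₁ y₂ M ∧ IsPrefix F₂ M) ∧
    (P₂ ≠ .nil → ∃ M, IsAlternatingPath c z₂ α₂ β₂ M ∧ IsPrefix P₂ M) ∧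
    (F₃ ≠ .nil → ∃ M, IsConditionalFan c z₂ α₂ β₂ y₃ M ∧ IsPrefix F₃ M) ∧
    (P₃ ≠ .nil → ∃ M, IsAlternatingPath c z₃ α₃ β₃ M ∧ IsPrefix P₃ M) ∧
    (∀ i j : Fin 6, i ≤ j →
      ![F₁, P₁, F₂, P₂, F₃, P₃] i = .nil → ![F₁, P₁, F₂, P₂, F₃, P₃] j = .nil) ∧
    (∀ i j : Fin 6, i ≠ j →
      ![F₁, P₁, F₂, P₂, F₃, P₃] i ≠ .nil → ![F₁, P₁, F₂, P₂, F₃, P₃] j ≠ .nil →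
        ![y₁, z₁, y₂, z₂, y₃, z₃] i ≠ ![y₁, z₁, y₂, z₂, y₃, z₃] j)

/-- The weight `∑_{f ∈ W} ρ(e, f)` of an edge injective chain `W`, seen from `e`; it may be
infinite if `W` is. -/
noncomputable def weight (ρ : G.edgeSet → G.edgeSet → ℝ) (e : G.edgeSet) (W : EdgeSeq G) : ℝ≥0∞ :=
  ∑' i, (W.get? i).elim 0 fun f => ENNReal.ofReal (ρ e f)

/-- The partial coloring `c` does not admit an improvement of weight `L`. -/
def NoImprovement [MeasurableSpace V] (ν : Measure G.edgeSet) (ρ : G.edgeSet → G.edgeSet → ℝ)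
    (c : G.edgeSet → Option (Fin n)) (L : ℕ) : Prop :=
  ν {e | e ∈ uncolored c ∧ ∃ W, IsThreeStepVizingChain c e W ∧ weight ρ e W ≤ L} = 0

end Coloring

end BorelVizing

open BorelVizing

/-! Say that c' improves c if almost no edge loses its color and ν(c ≠ c') + L ν(U_{c'}) ≤ L ν(U_c);
this contains the estimates to be proved. The relation is transitive. Along a sequence of
improvements the changes have total measure at most L ν(U) < ∞, so by Borel–Cantelli almost every
edge stabilizes, and the limit improves every term. A nearly greedy choice of the sequence therefore
yields an improvement whose ν(U) no further improvement can lower (`exists_maximal_improvement`). It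
remains to lower ν(U) whenever a non-null set of edges carries chains of weight at most L
(`exists_improvement`).

For this, many augmentations are performed at once. If those at the edges of a Borel set B do not
touch each other, they paste to a partial coloring; mass transport with the cocycle bounds the
measure of the changed edges by the integral of the weights, at most L ν(B), and all of B becomes
colored (`exists_improvement_of_independent`).

To find a non-null B, augmentations are described by countably many codes. Borel functions φ k
enumerate the components of the line graph, and a finite chain is coded by the finite list of its
recolored edges, named by indices k. Fans are finite, so an infinite chain ends with an infinite
alternating path. Since its start misses β, this path fills a whole α/β-component with exactly one
end (`IsRay.isKempeRoot`), and the shift along it is the exchange of α and β on that component. A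
code is thus a finite list together with, possibly, the index of the end and two colors.

For a fixed code, each edge conflicts with only finitely many edges at which the code is good
(`finite_conflict`): a one-ended component determines the edge where it is entered, and the φ k are
finite-to-one. A countable family of Borel sets separating points from finite sets then covers the
good edges by countably many conflict-free Borel sets, one of which is non-null. -/

namespace BorelVizing

/-! ### Borel uniformization for relations with sections of bounded size. -/

section Uniformization

theorem encard_le_of_insert_subset {α : Type*} {s t : Set α} {a : α} {N : ℕ} (ha : a ∉ s)
    (hst : insert a s ⊆ t) (ht : t.encard ≤ (N + 1 : ℕ)) : s.encard ≤ N := by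
  have h1 := (Set.encard_le_encard hst).trans ht
  rw [Set.encard_insert_of_notMem ha] at h1
  push_cast at h1
  exact (ENat.add_le_add_iff_right ENat.one_ne_top).1 h1

universe u

variable {Y : Type u} [MeasurableSpace Y] [StandardBorelSpace Y]

/-- A Borel relation with sections of at most one point has a Borel projection. -/
theorem measurableSet_fst_image_of_subsingleton {X : Type u} [MeasurableSpace X]
    [StandardBorelSpace X] {R : Set (X × Y)} (hR : MeasurableSet R)
    (h : ∀ x y y', (x, y) ∈ R → (x, y') ∈ R → y = y') : MeasurableSet (Prod.fst '' R) := by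
  refine hR.image_of_measurable_injOn measurable_fst ?_
  rintro ⟨x, y⟩ hp ⟨x', y'⟩ hp' (rfl : x = x')
  rw [h x y y' hp hp']

/-- The points of a relation which are not least in their section. -/
def notLeast {X : Type u} (R : Set (X × Y)) : Set (X × Y) :=
  Prod.fst '' {q : (X × Y) × Y | q.1 ∈ R ∧ (q.1.1, q.2) ∈ R ∧
    embeddingReal Y q.2 < embeddingReal Y q.1.2}

theorem mem_notLeast {X : Type u} {R : Set (X × Y)} {x : X} {y : Y} :
    (x, y) ∈ notLeast R ↔ (x, y) ∈ R ∧ ∃ y', (x, y') ∈ R ∧ embeddingReal Y y' < embeddingReal Y y := by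
  simp only [notLeast, Set.mem_image, Set.mem_ofPred_eq, Prod.exists, exists_and_right, exists_eq_right]
  constructor
  · rintro ⟨y', h⟩
    aesop
  · rintro ⟨h, y', h'⟩
    exact ⟨y', h, h'⟩

theorem eq_of_not_notLeast {X : Type u} {R : Set (X × Y)} {x : X} {y y' : Y}
    (h : (x, y) ∈ R \ notLeast R) (h' : (x, y') ∈ R \ notLeast R) : y = y' := by
  have h1 : ¬ embeddingReal Y y' < embeddingReal Y y := fun hlt =>
    h.2 (mem_notLeast.2 ⟨h.1, y', h'.1, hlt⟩)
  have h2 : ¬ embeddingReal Y y < embeddingReal Y y' := fun hlt =>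
    h'.2 (mem_notLeast.2 ⟨h'.1, y, h.1, hlt⟩)
  exact (measurableEmbedding_embeddingReal Y).injective (le_antisymm (not_lt.1 h1) (not_lt.1 h2))

theorem exists_not_notLeast {X : Type u} {R : Set (X × Y)} {x : X} {y : Y} (h : (x, y) ∈ R)
    (hf : {y | (x, y) ∈ R}.Finite) : ∃ y', (x, y') ∈ R \ notLeast R := by
  obtain ⟨m, hm, hmin⟩ := Set.exists_min_image _ (embeddingReal Y) hf ⟨y, h⟩
  refine ⟨m, hm, fun hn => ?_⟩
  obtain ⟨-, y', hy', hlt⟩ := mem_notLeast.1 hn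
  exact absurd (hmin y' hy') (not_le.2 hlt)

/-- The non-least points are a projection from (X × Y) × Y. The section over (x, y) consists of
points strictly below y, so it omits y and is smaller by one; hence the induction must range over
all base spaces X. What is left after removing the non-least points projects injectively, and the
Lusin–Souslin theorem applies. -/
theorem measurableSet_notLeast_and_fst_image (N : ℕ) : ∀ {X : Type u} [MeasurableSpace X]
    [StandardBorelSpace X] {R : Set (X × Y)}, MeasurableSet R →
    (∀ x, {y | (x, y) ∈ R}.encard ≤ N) →
      MeasurableSet (Prod.fst '' R) ∧ MeasurableSet (notLeast R) := by
  induction N with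
  | zero =>
    intro X _ _ R _ h
    have : R = ∅ := by
      ext ⟨x, y⟩
      have := h x
      simp only [Nat.cast_zero, nonpos_iff_eq_zero, Set.encard_eq_zero] at this
      simpa using Set.eq_empty_iff_forall_notMem.1 this y
    subst this
    have h0 : notLeast (∅ : Set (X × Y)) = ∅ := by
      ext ⟨x, y⟩
      simp [mem_notLeast]
    simp [h0]
  | succ N ih =>
    intro X _ _ R hR h
    have hnl : MeasurableSet (notLeast R) := by
      refine (ih (X := X × Y) (R := {q : (X × Y) × Y | q.1 ∈ R ∧ (q.1.1, q.2) ∈ R ∧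
        embeddingReal Y q.2 < embeddingReal Y q.1.2}) ?_ ?_).1
      · refine MeasurableSet.inter (measurable_fst hR) (MeasurableSet.inter ?_ ?_)
        · exact (show Measurable fun q : (X × Y) × Y => (q.1.1, q.2) by fun_prop) hR
        · have := measurable_embeddingReal Y
          exact measurableSet_lt (this.comp measurable_snd)
            (this.comp (measurable_snd.comp measurable_fst))
      · rintro ⟨x, y⟩
        by_cases hy : (x, y) ∈ R
        · refine encard_le_of_insert_subset (a := y) ?_ ?_ (h x)
          · simp
          · rintro z (rfl | hz)
            · exact hy
            · exact hz.2.1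
        · simp [hy]
    refine ⟨?_, hnl⟩
    have hM := measurableSet_fst_image_of_subsingleton (hR.diff hnl)
      fun x y y' => eq_of_not_notLeast
    convert hM using 1
    ext x
    constructor
    · rintro ⟨⟨x, y⟩, hy, rfl⟩
      obtain ⟨y', hy'⟩ := exists_not_notLeast hy
        (Set.finite_of_encard_le_coe (h x))
      exact ⟨_, hy', rfl⟩
    · exact fun hx => Set.image_mono Set.sdiff_subset hx

/-- Peeling off the least point of each section lowers the bound on the sections by one. -/
theorem exists_cover_of_encard_le {X : Type u} [MeasurableSpace X]
    [StandardBorelSpace X] (N : ℕ) : ∀ {R : Set (X × Y)}, MeasurableSet R →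
    (∀ x, {y | (x, y) ∈ R}.encard ≤ N) →
      ∃ M : ℕ → Set (X × Y), (∀ i, MeasurableSet (M i)) ∧ R = ⋃ i, M i ∧
        ∀ i x y y', (x, y) ∈ M i → (x, y') ∈ M i → y = y' := by
  induction N with
  | zero =>
    intro R _ h
    refine ⟨fun _ => ∅, by simp, ?_, by simp⟩
    ext ⟨x, y⟩
    have := h x
    simp only [Nat.cast_zero, nonpos_iff_eq_zero, Set.encard_eq_zero] at this
    simpa using Set.eq_empty_iff_forall_notMem.1 this y
  | succ N ih =>
    intro R hR h
    have hnl := (measurableSet_notLeast_and_fst_image _ hR h).2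
    have hsub : notLeast R ⊆ R := fun ⟨x, y⟩ hp => (mem_notLeast.1 hp).1
    obtain ⟨M, hM, hRM, hsec⟩ := ih hnl (fun x => by
      rcases Set.eq_empty_or_nonempty {y | (x, y) ∈ R} with h0 | ⟨y, hy⟩
      · have : {y | (x, y) ∈ notLeast R} = ∅ := by
          rw [← Set.subset_empty_iff, ← h0]
          exact fun y hy => hsub hy
        simp [this]
      · obtain ⟨y', hy'⟩ := exists_not_notLeast hy (Set.finite_of_encard_le_coe (h x))
        refine encard_le_of_insert_subset (a := y') hy'.2 ?_ (h x)
        rintro z (rfl | hz)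
        · exact hy'.1
        · exact hsub hz)
    refine ⟨fun i => i.casesOn (R \ notLeast R) M, ?_, ?_, ?_⟩
    · rintro (_ | i)
      exacts [hR.diff hnl, hM i]
    · rw [← Set.sdiff_union_of_subset hsub]
      ext p
      simp only [Set.mem_union, Set.mem_iUnion]
      constructor
      · rintro (hp | hp)
        · exact ⟨0, by simpa [Set.sdiff_union_of_subset hsub] using hp⟩
        · rw [hRM] at hp
          obtain ⟨i, hi⟩ := Set.mem_iUnion.1 hp
          exact ⟨i + 1, hi⟩
      · rintro ⟨_ | i, hi⟩
        · left
          simpa [Set.sdiff_union_of_subset hsub] using hi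
        · right
          rw [hRM]
          exact Set.mem_iUnion.2 ⟨i, hi⟩
    · rintro (_ | i) x y y' h1 h2
      · exact eq_of_not_notLeast h1 h2
      · exact hsec i x y y' h1 h2

/-- A reflexive Borel relation with sections of bounded size is enumerated by countably many Borel
functions. -/
theorem exists_measurable_enumeration {R : Set (Y × Y)} (hR : MeasurableSet R) (N : ℕ)
    (h : ∀ x, {y | (x, y) ∈ R}.encard ≤ N) (hrefl : ∀ x, (x, x) ∈ R) :
    ∃ ψ : ℕ → Y → Y, (∀ i, Measurable (ψ i)) ∧ ∀ x y, (x, y) ∈ R ↔ ∃ i, ψ i x = y := by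
  classical
  obtain ⟨M, hM, hRM, hsec⟩ := exists_cover_of_encard_le N hR h
  -- The default value x adds nothing to the relation, since R is reflexive.
  let ψ : ℕ → Y → Y := fun i x => if h : ∃ y, (x, y) ∈ M i then h.choose else x
  have hψ : ∀ i x y, (x, y) ∈ M i → ψ i x = y := fun i x y hxy => by
    have hex : ∃ y, (x, y) ∈ M i := ⟨y, hxy⟩
    simp only [ψ, dif_pos hex]
    exact hsec i x _ _ hex.choose_spec hxy
  refine ⟨ψ, fun i U hU => ?_, fun x y => ⟨fun hxy => ?_, ?_⟩⟩
  · have h1 : MeasurableSet (Prod.fst '' (M i)) :=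
      measurableSet_fst_image_of_subsingleton (hM i) (hsec i)
    have h2 : MeasurableSet (Prod.fst '' (M i ∩ Prod.snd ⁻¹' U)) :=
      measurableSet_fst_image_of_subsingleton ((hM i).inter (measurable_snd hU))
        fun x y y' hy hy' => hsec i x y y' hy.1 hy'.1
    convert h2.union (hU.diff h1) using 1
    ext x
    by_cases hex : ∃ y, (x, y) ∈ M i
    · obtain ⟨y, hy⟩ := hex
      have hx1 : x ∈ Prod.fst '' M i := ⟨_, hy, rfl⟩
      simp only [Set.mem_preimage, hψ i x y hy, Set.mem_union, Set.mem_sdiff, hx1, not_true,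
        and_false, or_false]
      constructor
      · exact fun hyU => ⟨(x, y), ⟨hy, hyU⟩, rfl⟩
      · rintro ⟨⟨x', y'⟩, ⟨h3, h4⟩, rfl⟩
        rwa [hsec i _ _ _ hy h3]
    · have hx1 : x ∉ Prod.fst '' M i := by
        rintro ⟨⟨x, y⟩, hy, rfl⟩
        exact hex ⟨y, hy⟩
      have hx2 : x ∉ Prod.fst '' (M i ∩ Prod.snd ⁻¹' U) :=
        fun hx => hx1 (Set.image_mono Set.inter_subset_left hx)
      simp [ψ, hex, hx1, hx2, -Set.mem_image]
  · rw [hRM] at hxy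
    obtain ⟨i, hi⟩ := Set.mem_iUnion.1 hxy
    exact ⟨i, hψ i x y hi⟩
  · rintro ⟨i, rfl⟩
    by_cases hex : ∃ y, (x, y) ∈ M i
    · simp only [ψ, dif_pos hex, hRM]
      exact Set.mem_iUnion.2 ⟨i, hex.choose_spec⟩
    · simp only [ψ, dif_neg hex]
      exact hrefl x

end Uniformization

/-! ### Borel enumeration of connected components. -/

/-- `φ` is a sequence of finite-to-one Borel functions which enumerates the components of `H`. -/
structure IsComponentEnumeration {X : Type*} [MeasurableSpace X] (H : SimpleGraph X)
    (φ : ℕ → X → X) : Prop where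
  measurable : ∀ i, Measurable (φ i)
  reachable_iff : ∀ x y, H.Reachable x y ↔ ∃ i, φ i x = y
  finite_fiber : ∀ i y, {x | φ i x = y}.Finite

/-- The one-step moves are enumerated by Borel functions, and compositions along finite words reach
the whole component. By symmetry of adjacency a fiber of a one-step move lies in a closed
neighborhood, hence is finite, and this passes to compositions. -/
theorem exists_componentEnumeration {X : Type*} [MeasurableSpace X] [StandardBorelSpace X]
    (H : SimpleGraph X) (hH : MeasurableSet {p : X × X | p.1 = p.2 ∨ H.Adj p.1 p.2}) (N : ℕ)
    (hN : ∀ x, {y | x = y ∨ H.Adj x y}.encard ≤ N) :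
    ∃ φ : ℕ → X → X, IsComponentEnumeration H φ := by
  obtain ⟨ψ, hψ, hψR⟩ := exists_measurable_enumeration hH N hN (fun x => Or.inl rfl)
  let θ : List ℕ → X → X := fun w => w.foldr (fun i g => ψ i ∘ g) id
  have hcons : ∀ i w, θ (i :: w) = ψ i ∘ θ w := fun i w => rfl
  have hfin : ∀ i y, {x | ψ i x = y}.Finite := fun i y => by
    refine (Set.finite_of_encard_le_coe (hN y)).subset fun x hx => ?_
    rcases (hψR x y).2 ⟨i, hx⟩ with h | h
    · exact Or.inl h.symm
    · exact Or.inr h.symm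
  obtain ⟨enc, henc⟩ := exists_surjective_nat (List ℕ)
  refine ⟨fun i => θ (enc i), ⟨fun i => ?_, fun x y => ?_, fun i y => ?_⟩⟩
  · induction enc i with
    | nil => exact measurable_id
    | cons j w ih => exact (hψ j).comp ih
  · rw [← henc.exists (p := fun w => θ w x = y)]
    constructor
    · intro h
      rw [SimpleGraph.reachable_iff_reflTransGen] at h
      induction h with
      | refl => exact ⟨[], rfl⟩
      | tail _ hadj ih =>
        obtain ⟨w, rfl⟩ := ih
        obtain ⟨i, hi⟩ := (hψR _ _).1 (Or.inr hadj)
        exact ⟨i :: w, hi⟩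
    · rintro ⟨w, rfl⟩
      induction w with
      | nil => exact SimpleGraph.Reachable.refl x
      | cons j w ih =>
        refine ih.trans ?_
        rcases (hψR (θ w x) (θ (j :: w) x)).2 ⟨j, rfl⟩ with h | h
        · simp only at h
          rw [← h]
        · exact h.reachable
  · induction enc i generalizing y with
    | nil => exact Set.finite_singleton y |>.subset fun x hx => hx
    | cons j w ih =>
      have : {x | θ (j :: w) x = y} = ⋃ z ∈ {z | ψ j z = y}, {x | θ w x = z} := by
        ext x
        simp [hcons]
      rw [this]
      exact (hfin j y).biUnion fun z _ => ih z

/-! ### The edge set is a standard Borel space. -/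

section EdgeSpace

theorem standardBorelSpace_of_measurableEquiv {α β : Type*} [MeasurableSpace α]
    [MeasurableSpace β] [StandardBorelSpace β] (e : α ≃ᵐ β) : StandardBorelSpace α := by
  let := upgradeStandardBorel β
  let : TopologicalSpace α := TopologicalSpace.induced e inferInstance
  refine ⟨inferInstance, ⟨?_⟩, e.toEquiv.polishSpace_induced⟩
  rw [borel_comap, ← BorelSpace.measurable_eq (α := β)]
  exact e.measurableEmbedding.comap_eq.symm

variable {V : Type*} [MeasurableSpace V]

theorem measurable_sym2_iff {Z : Type*} [MeasurableSpace Z] {f : Sym2 V → Z} :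
    Measurable f ↔ Measurable fun p : V × V => f s(p.1, p.2) := Iff.rfl

variable [StandardBorelSpace V]

open Classical in
/-- The vertices of an unordered pair, sorted by a Borel linear order. -/
noncomputable def sortedPair (e : Sym2 V) : V × V :=
  e.lift ⟨fun x y => if embeddingReal V x ≤ embeddingReal V y then (x, y) else (y, x), fun x y => by
    have hinj := (measurableEmbedding_embeddingReal V).injective
    beta_reduce
    split_ifs with h1 h2 h2
    · rw [hinj (le_antisymm h1 h2)]
    · rfl
    · rfl
    · exact absurd (not_le.1 h1).le h2⟩

theorem mk_sortedPair (e : Sym2 V) : s((sortedPair e).1, (sortedPair e).2) = e := by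
  induction e with
  | _ x y =>
    simp only [sortedPair, Sym2.lift_mk]
    split_ifs
    · rfl
    · exact Sym2.eq_swap

theorem sortedPair_le (e : Sym2 V) :
    embeddingReal V (sortedPair e).1 ≤ embeddingReal V (sortedPair e).2 := by
  induction e with
  | _ x y =>
    simp only [sortedPair, Sym2.lift_mk]
    split_ifs with h
    · exact h
    · exact (not_le.1 h).le

theorem measurable_sortedPair : Measurable (sortedPair : Sym2 V → V × V) := by
  classical
  rw [measurable_sym2_iff]
  simp only [sortedPair, Sym2.lift_mk]
  have := measurable_embeddingReal V
  exact Measurable.ite (measurableSet_le (this.comp measurable_fst) (this.comp measurable_snd))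
    measurable_id measurable_swap

/-- Sorting the two vertices identifies unordered pairs with a Borel half of V × V. -/
theorem standardBorelSpace_sym2 : StandardBorelSpace (Sym2 V) := by
  have hj := measurable_embeddingReal V
  let S : Set (V × V) := {p | embeddingReal V p.1 ≤ embeddingReal V p.2}
  have hS : MeasurableSet S :=
    measurableSet_le (hj.comp measurable_fst) (hj.comp measurable_snd)
  have := hS.standardBorel
  refine standardBorelSpace_of_measurableEquiv (β := S)
    { toFun := fun e => ⟨sortedPair e, sortedPair_le e⟩
      invFun := fun p => s(p.1.1, p.1.2)
      left_inv := mk_sortedPair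
      right_inv := ?_
      measurable_toFun := measurable_sortedPair.subtype_mk
      measurable_invFun := (measurable_sym2_iff.1 measurable_id).comp measurable_subtype_coe }
  rintro ⟨⟨x, y⟩, h⟩
  have h' : embeddingReal V x ≤ embeddingReal V y := h
  ext1
  simp [sortedPair, h']

variable {G : SimpleGraph V}

theorem standardBorelSpace_edgeSet (hG : MeasurableSet G.edgeSet) :
    StandardBorelSpace G.edgeSet := by
  have := standardBorelSpace_sym2 (V := V)
  exact hG.standardBorel

end EdgeSpace

/-! ### Incidence of edges: measurability and degree bounds. -/

section Touch

variable {V : Type*} {G : SimpleGraph V}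

/-- The edges `e` and `f` share a vertex. -/
def Touch (e f : G.edgeSet) : Prop := ∃ x, x ∈ e.1 ∧ x ∈ f.1

theorem Touch.symm {e f : G.edgeSet} (h : Touch e f) : Touch f e :=
  let ⟨x, h1, h2⟩ := h
  ⟨x, h2, h1⟩

theorem touch_refl (e : G.edgeSet) : Touch e e := by
  obtain ⟨e, he⟩ := e
  induction e with
  | _ x y => exact ⟨x, by simp, by simp⟩

theorem touch_iff {e f : G.edgeSet} : Touch e f ↔ e = f ∨ G.lineGraph.Adj e f := by
  rw [SimpleGraph.lineGraph_adj_iff_exists]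
  constructor
  · intro h
    by_cases hef : e = f
    · exact Or.inl hef
    · exact Or.inr ⟨hef, h⟩
  · rintro (rfl | h)
    · exact touch_refl e
    · exact h.2

theorem Touch.reachable {e f : G.edgeSet} (h : Touch e f) : G.lineGraph.Reachable e f := by
  rcases touch_iff.1 h with rfl | h
  · exact SimpleGraph.Reachable.refl e
  · exact h.reachable

theorem measurableSet_touch [MeasurableSpace V] [StandardBorelSpace V] :
    MeasurableSet {p : G.edgeSet × G.edgeSet | Touch p.1 p.2} := by
  have hs : Measurable fun e : G.edgeSet => sortedPair e.1 :=
    measurable_sortedPair.comp measurable_subtype_coe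
  have hs1 : Measurable fun p : G.edgeSet × G.edgeSet => sortedPair p.1.1 := hs.comp measurable_fst
  have hs2 : Measurable fun p : G.edgeSet × G.edgeSet => sortedPair p.2.1 := hs.comp measurable_snd
  have hmem : ∀ (e : Sym2 V) x, x ∈ e ↔ x = (sortedPair e).1 ∨ x = (sortedPair e).2 := by
    intro e x
    conv_lhs => rw [← mk_sortedPair e]
    exact Sym2.mem_iff
  have : {p : G.edgeSet × G.edgeSet | Touch p.1 p.2} =
      (({p | (sortedPair p.1.1).1 = (sortedPair p.2.1).1} ∪
        {p | (sortedPair p.1.1).1 = (sortedPair p.2.1).2}) ∪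
      ({p | (sortedPair p.1.1).2 = (sortedPair p.2.1).1} ∪
        {p | (sortedPair p.1.1).2 = (sortedPair p.2.1).2})) := by
    ext p
    simp only [Touch, hmem, Set.mem_ofPred_eq, Set.mem_union]
    aesop
  rw [this]
  exact ((measurableSet_eq_fun hs1.fst hs2.fst).union (measurableSet_eq_fun hs1.fst hs2.snd)).union
    ((measurableSet_eq_fun hs1.snd hs2.fst).union (measurableSet_eq_fun hs1.snd hs2.snd))

theorem encard_incident_le {Δ : ℕ} (hΔ : IsMaxDegree G Δ) (x : V) :
    {f : G.edgeSet | x ∈ f.1}.encard ≤ Δ := by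
  refine le_trans ?_ (hΔ.1 x)
  rw [← Function.Injective.encard_image Subtype.val_injective]
  refine (Set.encard_le_encard (t := (fun w => s(x, w)) '' G.neighborSet x) ?_).trans
    (Set.encard_image_le _ _)
  rintro _ ⟨⟨f, hf⟩, hx, rfl⟩
  obtain ⟨w, rfl⟩ := Sym2.mem_iff_exists.1 hx
  exact ⟨w, hf, rfl⟩

theorem encard_touch_le {Δ : ℕ} (hΔ : IsMaxDegree G Δ) (e : G.edgeSet) :
    {f | Touch e f}.encard ≤ (Δ + Δ : ℕ) := by
  obtain ⟨e, he⟩ := e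
  induction e with
  | _ x y =>
    refine (Set.encard_le_encard (t := {f | x ∈ f.1} ∪ {f | y ∈ f.1}) ?_).trans
      ((Set.encard_union_le _ _).trans ?_)
    · rintro f ⟨z, hz, hzf⟩
      rcases Sym2.mem_iff.1 hz with rfl | rfl
      · exact Or.inl hzf
      · exact Or.inr hzf
    · push_cast
      exact add_le_add (encard_incident_le hΔ x) (encard_incident_le hΔ y)

theorem finite_touch {Δ : ℕ} (hΔ : IsMaxDegree G Δ) (e : G.edgeSet) : {f | Touch e f}.Finite :=
  Set.finite_of_encard_le_coe (encard_touch_le hΔ e)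

theorem exists_lineGraph_componentEnumeration [MeasurableSpace V] [StandardBorelSpace V]
    (hG : MeasurableSet G.edgeSet) {Δ : ℕ} (hΔ : IsMaxDegree G Δ) :
    ∃ φ : ℕ → G.edgeSet → G.edgeSet, IsComponentEnumeration G.lineGraph φ := by
  have := standardBorelSpace_edgeSet hG
  refine exists_componentEnumeration _ ?_ (Δ + Δ) ?_
  · simp only [← touch_iff]
    exact measurableSet_touch
  · intro e
    simp only [← touch_iff]
    exact encard_touch_le hΔ e

end Touch

/-! ### Pointwise limits of colorings. -/

section Limit

variable {V : Type*} {G : SimpleGraph V} {n : ℕ}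

open Classical in
/-- The pointwise limit of a sequence of partial colorings, uncolored where there is no limit. -/
noncomputable def limitColoring (s : ℕ → G.edgeSet → Option (Fin n)) (e : G.edgeSet) :
    Option (Fin n) :=
  if h : ∃ a, ∀ᶠ m in Filter.atTop, s m e = some a then some h.choose else none

theorem limitColoring_eq_some_iff {s : ℕ → G.edgeSet → Option (Fin n)} {e : G.edgeSet}
    {a : Fin n} : limitColoring s e = some a ↔ ∀ᶠ m in Filter.atTop, s m e = some a := by
  unfold limitColoring
  split_ifs with h
  · constructor
    · intro h'
      rw [← h']
      exact h.choose_spec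
    · intro h'
      obtain ⟨m, hm1, hm2⟩ := (h'.and h.choose_spec).exists
      rw [← hm2, hm1]
  · constructor
    · simp
    · exact fun h' => absurd ⟨a, h'⟩ h

theorem limitColoring_eq_of_eventually {s : ℕ → G.edgeSet → Option (Fin n)} {e : G.edgeSet}
    {a : Option (Fin n)} (h : ∀ᶠ m in Filter.atTop, s m e = a) : limitColoring s e = a := by
  cases a with
  | some a => exact limitColoring_eq_some_iff.2 h
  | none =>
    by_contra hne
    obtain ⟨b, hb⟩ := Option.ne_none_iff_exists'.1 hne
    obtain ⟨m, hm1, hm2⟩ := (h.and (limitColoring_eq_some_iff.1 hb)).exists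
    simp [hm1] at hm2

theorem eq_of_forall_succ_eq {α : Type*} {u : ℕ → α} {k : ℕ} (h : ∀ m ≥ k, u m = u (m + 1)) :
    ∀ m ≥ k, u m = u k := by
  intro m hm
  induction m, hm using Nat.le_induction with
  | base => rfl
  | succ m hm ih => rw [← h m hm, ih]

end Limit

/-! ### Improvements, their limits, and a maximal one. -/

section Exhaustion

variable {V : Type*} [MeasurableSpace V] {G : SimpleGraph V} {n : ℕ}

theorem IsPartialColoring.measurableSet_fiber {c : G.edgeSet → Option (Fin n)}
    (hc : IsPartialColoring c) (a : Option (Fin n)) : MeasurableSet {e | c e = a} := by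
  cases a with
  | some a => exact hc.measurableSet_color a
  | none =>
    have : {e | c e = none} = (⋃ a, {e | c e = some a})ᶜ := by
      ext e
      cases h : c e <;> simp [h]
    rw [this]
    exact (MeasurableSet.iUnion hc.measurableSet_color).compl

/-- `c'` colors almost all edges that `c` colors, and its difference from `c` has measure at most
`L` times the measure of the additionally colored edges. -/
structure Improves (ν : Measure G.edgeSet) (L : ℕ) (c c' : G.edgeSet → Option (Fin n)) : Prop where
  dom : ν {e | c e ≠ none ∧ c' e = none} = 0
  diff : ν {e | c e ≠ c' e} + L * ν (uncolored c') ≤ L * ν (uncolored c)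

variable {ν : Measure G.edgeSet} {L : ℕ} {c c' c'' : G.edgeSet → Option (Fin n)}

theorem Improves.refl (c : G.edgeSet → Option (Fin n)) : Improves ν L c c := by
  constructor
  · rw [show {e | c e ≠ none ∧ c e = none} = ∅ by ext; simp]
    exact measure_empty
  · simp

theorem Improves.measure_uncolored_le (h : Improves ν L c c') :
    ν (uncolored c') ≤ ν (uncolored c) := by
  calc ν (uncolored c') ≤ ν (uncolored c ∪ {e | c e ≠ none ∧ c' e = none}) := by
        refine measure_mono fun e (he : c' e = none) => ?_
        by_cases h : c e = none
        · exact Or.inl h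
        · exact Or.inr ⟨h, he⟩
    _ ≤ ν (uncolored c) + 0 := (measure_union_le _ _).trans_eq (by rw [h.dom])
    _ = _ := add_zero _

/-- The difference sets obey the triangle inequality, while L times the measure of the uncolored set
telescopes. Having that term on the left avoids truncated subtraction. -/
theorem Improves.trans (h : Improves ν L c c') (h' : Improves ν L c' c'') :
    Improves ν L c c'' := by
  constructor
  · refine measure_mono_null (t := _ ∪ _) (fun e he => ?_) (measure_union_null h.dom h'.dom)
    by_cases h1 : c' e = none
    · exact Or.inl ⟨he.1, h1⟩
    · exact Or.inr ⟨h1, he.2⟩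
  · calc ν {e | c e ≠ c'' e} + L * ν (uncolored c'')
        ≤ ν ({e | c e ≠ c' e} ∪ {e | c' e ≠ c'' e}) + L * ν (uncolored c'') := by
          gcongr
          intro e he
          by_cases h1 : c e = c' e
          · exact Or.inr fun h2 => he (h1.trans h2)
          · exact Or.inl h1
      _ ≤ ν {e | c e ≠ c' e} + (ν {e | c' e ≠ c'' e} + L * ν (uncolored c'')) := by
          rw [← add_assoc]
          gcongr
          exact measure_union_le _ _
      _ ≤ ν {e | c e ≠ c' e} + L * ν (uncolored c') := by gcongr; exact h'.diff
      _ ≤ _ := h.diff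

theorem isPartialColoring_limitColoring {s : ℕ → G.edgeSet → Option (Fin n)}
    (hs : ∀ m, IsPartialColoring (s m)) : IsPartialColoring (limitColoring s) := by
  constructor
  · intro a
    simp only [limitColoring_eq_some_iff, Filter.eventually_atTop]
    have : {e | ∃ N, ∀ m ≥ N, s m e = some a} = ⋃ N, ⋂ m, ⋂ (_ : m ≥ N), {e | s m e = some a} := by
      ext; simp
    rw [this]
    exact MeasurableSet.iUnion fun N => MeasurableSet.iInter fun m => MeasurableSet.iInter fun _ =>
      (hs m).measurableSet_color a
  · intro e f hef ht a he hf
    rw [limitColoring_eq_some_iff] at he hf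
    obtain ⟨m, hm1, hm2⟩ := (he.and hf).exists
    exact (hs m).proper e f hef ht a hm1 hm2

theorem sum_measure_ne_add_le {s : ℕ → G.edgeSet → Option (Fin n)}
    (h : ∀ m, Improves ν L (s m) (s (m + 1))) (k N : ℕ) :
    ∑ i ∈ Finset.range N, ν {e | s (k + i) e ≠ s (k + i + 1) e} + L * ν (uncolored (s (k + N))) ≤
      L * ν (uncolored (s k)) := by
  induction N with
  | zero => simp
  | succ N ih =>
    rw [Finset.sum_range_succ, add_assoc]
    exact (add_le_add_right (h (k + N)).diff _).trans ih

/-- Telescoping bounds the total measure of all changes by L times the initial uncolored measure,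
which is finite. By Borel–Cantelli almost every edge changes only finitely often and takes its limit
value from some stage on. -/
theorem improves_limitColoring [IsFiniteMeasure ν] {s : ℕ → G.edgeSet → Option (Fin n)}
    (h : ∀ m, Improves ν L (s m) (s (m + 1))) (k : ℕ) : Improves ν L (s k) (limitColoring s) := by
  have hfin : ∀ e : Set G.edgeSet, (L : ℝ≥0∞) * ν e ≠ ∞ := fun e =>
    ENNReal.mul_ne_top (by simp) (measure_ne_top _ _)
  have hmono : ∀ i j, Improves ν L (s i) (s (i + j)) := fun i j => by
    induction j with
    | zero => exact Improves.refl _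
    | succ j ih => exact ih.trans (h _)
  have hsum : ∑' i, ν {e | s i e ≠ s (i + 1) e} ≠ ∞ := by
    refine ne_top_of_le_ne_top (hfin (uncolored (s 0))) (ENNReal.tsum_le_of_sum_range_le fun N => ?_)
    have := sum_measure_ne_add_le h 0 N
    simp only [zero_add] at this
    exact le_self_add.trans this
  have hev : ∀ᵐ e ∂ν, ∃ N, (∀ m ≥ N, s m e = s N e) ∧ limitColoring s e = s N e := by
    filter_upwards [ae_eventually_notMem hsum] with e he
    obtain ⟨N, hN⟩ := Filter.eventually_atTop.1 he
    have := eq_of_forall_succ_eq (u := fun m => s m e) (k := N)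
      fun m hm => not_not.1 (hN m hm)
    exact ⟨N, this, limitColoring_eq_of_eventually
      (Filter.eventually_atTop.2 ⟨N, this⟩)⟩
  have hdom : ∀ i, ν {e | s i e ≠ none ∧ limitColoring s e = none} = 0 := by
    intro i
    have h1 : ∀ᵐ e ∂ν, ∀ j, ¬ (s i e ≠ none ∧ s (i + j) e = none) :=
      ae_all_iff.2 fun j => by
        rw [ae_iff]
        simpa only [not_not] using (hmono i j).dom
    have h2 : ∀ᵐ e ∂ν, ¬ (s i e ≠ none ∧ limitColoring s e = none) := by
      filter_upwards [hev, h1] with e ⟨N, hN1, hN2⟩ h1 h3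
      refine h1 N ⟨h3.1, ?_⟩
      rw [hN1 _ (by omega), ← hN2, h3.2]
    rw [ae_iff] at h2
    simpa only [not_not] using h2
  have hU : ∀ i, ν (uncolored (limitColoring s)) ≤ ν (uncolored (s i)) := fun i => by
    calc ν (uncolored (limitColoring s))
        ≤ ν (uncolored (s i) ∪ {e | s i e ≠ none ∧ limitColoring s e = none}) := by
          refine measure_mono fun e (he : limitColoring s e = none) => ?_
          by_cases h : s i e = none
          · exact Or.inl h
          · exact Or.inr ⟨h, he⟩
      _ ≤ ν (uncolored (s i)) + 0 := (measure_union_le _ _).trans_eq (by rw [hdom])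
      _ = _ := add_zero _
  -- An edge whose color at stage k differs from the limit changes at some later step; the partial
  -- sums of these changes are bounded by telescoping.
  refine ⟨hdom k, ?_⟩
  have h1 : ν {e | s k e ≠ limitColoring s e} ≤ ∑' i, ν {e | s (k + i) e ≠ s (k + i + 1) e} := by
    refine (measure_mono fun e he => ?_).trans (measure_iUnion_le _)
    by_contra hcon
    simp only [Set.mem_iUnion, Set.mem_ofPred_eq, not_exists, not_not] at hcon
    have h2 := eq_of_forall_succ_eq (u := fun m => s m e) (k := k) fun m hm => by
      obtain ⟨j, rfl⟩ := Nat.exists_eq_add_of_le hm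
      exact hcon j
    exact he (limitColoring_eq_of_eventually (Filter.eventually_atTop.2 ⟨k, h2⟩)).symm
  refine (add_le_add_left h1 _).trans ?_
  rw [ENNReal.tsum_eq_iSup_nat, ENNReal.iSup_add]
  refine iSup_le fun N => le_trans ?_ (sum_measure_ne_add_le h k N)
  exact add_le_add le_rfl (mul_le_mul' le_rfl (hU _))

/-- Exhaustion: a partial coloring can be improved until the measure of the uncolored edges cannot
be decreased any more. -/
theorem exists_maximal_improvement [IsFiniteMeasure ν] (hc : IsPartialColoring c) :
    ∃ c', IsPartialColoring c' ∧ Improves ν L c c' ∧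
      ∀ c'', IsPartialColoring c'' → Improves ν L c' c'' →
        ν (uncolored c') ≤ ν (uncolored c'') := by
  have hstep : ∀ (N : ℕ) (d : G.edgeSet → Option (Fin n)), IsPartialColoring d →
      ∃ d', IsPartialColoring d' ∧ Improves ν L d d' ∧ ∀ d'', IsPartialColoring d'' →
        Improves ν L d d'' → ν (uncolored d') ≤ ν (uncolored d'') + (N + 1 : ℝ≥0∞)⁻¹ := by
    intro N d hd
    let S : Set ℝ≥0∞ := {r | ∃ d', IsPartialColoring d' ∧ Improves ν L d d' ∧ r = ν (uncolored d')}
    have hS : ν (uncolored d) ∈ S := ⟨d, hd, Improves.refl d, rfl⟩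
    -- The infimum need not be attained; stage N comes within 1 / (N + 1) of it.
    have hlt : sInf S < sInf S + (N + 1 : ℝ≥0∞)⁻¹ := by
      refine ENNReal.lt_add_right ?_ ?_
      · exact ne_top_of_le_ne_top (measure_ne_top _ _) (sInf_le hS)
      · exact ENNReal.inv_ne_zero.2 (by finiteness)
    obtain ⟨_, ⟨d', hd', himp, rfl⟩, hlt'⟩ := sInf_lt_iff.1 hlt
    refine ⟨d', hd', himp, fun d'' hd'' himp' => hlt'.le.trans ?_⟩
    gcongr
    exact sInf_le ⟨d'', hd'', himp', rfl⟩
  choose g hg1 hg2 hg3 using hstep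
  let s : ℕ → {d : G.edgeSet → Option (Fin n) // IsPartialColoring d} := fun N =>
    N.rec ⟨c, hc⟩ fun N d => ⟨g N d.1 d.2, hg1 N d.1 d.2⟩
  have hs : ∀ m, Improves ν L (s m).1 (s (m + 1)).1 := fun m => hg2 m _ (s m).2
  have hlim := improves_limitColoring (s := fun m => (s m).1) hs
  refine ⟨_, isPartialColoring_limitColoring fun m => (s m).2, hlim 0, fun c'' hc'' himp => ?_⟩
  -- By transitivity, an improvement of the limit was already a competitor at every stage N.
  have hle : ∀ N : ℕ, ν (uncolored (limitColoring fun m => (s m).1)) ≤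
      ν (uncolored c'') + (N + 1 : ℝ≥0∞)⁻¹ := fun N =>
    (hlim (N + 1)).measure_uncolored_le.trans (hg3 N _ (s N).2 c'' hc'' ((hlim N).trans himp))
  have htend : Filter.Tendsto (fun N : ℕ => ν (uncolored c'') + (N + 1 : ℝ≥0∞)⁻¹) Filter.atTop
      (nhds (ν (uncolored c'') + 0)) := by
    refine Filter.Tendsto.add tendsto_const_nhds ?_
    have := (Filter.tendsto_add_atTop_iff_nat 1).2 ENNReal.tendsto_inv_nat_nhds_zero
    simpa using this
  rw [add_zero] at htend
  exact ge_of_tendsto' htend hle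

end Exhaustion

/-! ### Mass transport along the cocycle. -/

section Transport

variable {X : Type*} [MeasurableSpace X]

open Classical in
/-- The sum of `ρ e f` over the points `f` of `S` in the component of `e`, which is enumerated
by `φ`. -/
noncomputable def sumAlong (φ : ℕ → X → X) (ρ : X → X → ℝ) (e : X) (S : Set X) : ℝ≥0∞ :=
  -- Only the first index of a point counts, because the enumeration may repeat points.
  ∑' k, if φ k e ∈ S ∧ ∀ j < k, φ j e ≠ φ k e then ENNReal.ofReal (ρ e (φ k e)) else 0

theorem IsComponentEnumeration.reachable {H : SimpleGraph X} {φ : ℕ → X → X}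
    (hφ : IsComponentEnumeration H φ) (k : ℕ) (x : X) : H.Reachable x (φ k x) :=
  (hφ.reachable_iff _ _).2 ⟨k, rfl⟩

theorem measurable_cocycle {H : SimpleGraph X} {φ : ℕ → X → X} {μ : Measure X}
    (hφ : IsComponentEnumeration H φ) {ρ : X → X → ℝ} (hρ : IsRadonNikodymCocycle H μ ρ) (k : ℕ) :
    Measurable fun e => ENNReal.ofReal (ρ e (φ k e)) := by
  refine ENNReal.measurable_ofReal.comp ?_
  exact hρ.measurable.comp (f := fun e => ⟨(e, φ k e), hφ.reachable k e⟩)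
    ((measurable_id.prodMk (hφ.measurable k)).subtype_mk)

theorem measurable_snd_iterate {H : SimpleGraph X} {φ : ℕ → X → X}
    (hφ : IsComponentEnumeration H φ) {S : Set (X × X)} (hS : MeasurableSet S) (k : ℕ) :
    MeasurableSet {e | (e, φ k e) ∈ S} :=
  (measurable_id.prodMk (hφ.measurable k)) hS

variable [StandardBorelSpace X]

theorem measurableSet_first_hit {H : SimpleGraph X} {φ : ℕ → X → X}
    (hφ : IsComponentEnumeration H φ) {S : Set (X × X)} (hS : MeasurableSet S) (k : ℕ) :
    MeasurableSet {e | φ k e ∈ {f | (e, f) ∈ S} ∧ ∀ j < k, φ j e ≠ φ k e} := by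
  have : {e | ∀ j < k, φ j e ≠ φ k e} = ⋂ j, ⋂ (_ : j < k), {e | φ j e = φ k e}ᶜ := by
    ext; simp
  have h : MeasurableSet {e | ∀ j < k, φ j e ≠ φ k e} := by
    rw [this]
    exact MeasurableSet.iInter fun j => MeasurableSet.iInter fun _ =>
      (measurableSet_eq_fun (hφ.measurable j) (hφ.measurable k)).compl
  exact (measurable_snd_iterate hφ hS k).inter h

theorem measurable_sumAlong {H : SimpleGraph X} {φ : ℕ → X → X} {μ : Measure X}
    (hφ : IsComponentEnumeration H φ) {ρ : X → X → ℝ} (hρ : IsRadonNikodymCocycle H μ ρ)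
    {S : Set (X × X)} (hS : MeasurableSet S) :
    Measurable fun e => sumAlong φ ρ e {f | (e, f) ∈ S} := by
  classical
  unfold sumAlong
  exact Measurable.tsum fun k =>
    Measurable.ite (measurableSet_first_hit hφ hS k) (measurable_cocycle hφ hρ k) measurable_const

/-- Mass transport: the union of a family of pairwise disjoint sets `S e` is measured by the sums
of the cocycle along them. -/
theorem measure_biUnion_le_lintegral_sumAlong {H : SimpleGraph X} {φ : ℕ → X → X} {μ : Measure X}
    (hφ : IsComponentEnumeration H φ) {ρ : X → X → ℝ} (hρ : IsRadonNikodymCocycle H μ ρ)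
    {S : Set (X × X)} (hS : MeasurableSet S) {B : Set X} (hB : MeasurableSet B)
    (hreach : ∀ e ∈ B, ∀ f, (e, f) ∈ S → H.Reachable e f)
    (hdisj : ∀ e ∈ B, ∀ e' ∈ B, ∀ f, (e, f) ∈ S → (e', f) ∈ S → e = e') :
    μ {f | ∃ e ∈ B, (e, f) ∈ S} ≤ ∫⁻ e in B, sumAlong φ ρ e {f | (e, f) ∈ S} ∂μ := by
  classical
  -- Disjointness of the sections of S makes φ k injective on B ∩ D k, so the cocycle identity
  -- applies to each index separately.
  let D : ℕ → Set X := fun k => {e | φ k e ∈ {f | (e, f) ∈ S} ∧ ∀ j < k, φ j e ≠ φ k e}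
  have hD : ∀ k, MeasurableSet (D k) := measurableSet_first_hit hφ hS
  have himage : ∀ k, μ (φ k '' (B ∩ D k)) =
      ∫⁻ e in B, (D k).indicator (fun e => ENNReal.ofReal (ρ e (φ k e))) e ∂μ := fun k => by
    rw [hρ.measure_image (B ∩ D k) (φ k) (hB.inter (hD k))
      ((hφ.measurable k).comp measurable_subtype_coe) ?_ fun x _ => hφ.reachable k x,
      lintegral_indicator (hD k), Measure.restrict_restrict (hD k), Set.inter_comm]
    intro e he e' he' heq
    refine hdisj e he.1 e' he'.1 (φ k e) he.2.1 ?_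
    rw [heq]
    exact he'.2.1
  calc μ {f | ∃ e ∈ B, (e, f) ∈ S} ≤ μ (⋃ k, φ k '' (B ∩ D k)) := by
        refine measure_mono ?_
        rintro f ⟨e, heB, hef⟩
        have hex := (hφ.reachable_iff _ _).1 (hreach e heB f hef)
        have hspec := Nat.find_spec hex
        refine Set.mem_iUnion.2 ⟨Nat.find hex, e, ⟨heB, ?_, fun j hj => ?_⟩, hspec⟩
        · rw [hspec]
          exact hef
        · rw [hspec]
          exact Nat.find_min hex hj
    _ ≤ ∑' k, μ (φ k '' (B ∩ D k)) := measure_iUnion_le _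
    _ = ∫⁻ e in B, ∑' k, (D k).indicator (fun e => ENNReal.ofReal (ρ e (φ k e))) e ∂μ := by
        rw [lintegral_tsum fun k => ((measurable_cocycle hφ hρ k).indicator (hD k)).aemeasurable]
        exact tsum_congr himage
    _ = ∫⁻ e in B, sumAlong φ ρ e {f | (e, f) ∈ S} ∂μ := by
        simp only [sumAlong, Set.indicator_apply]
        rfl

end Transport

/-! ### Simultaneous non-touching modifications. -/

section Paste

variable {V : Type*} {G : SimpleGraph V} {n : ℕ}

open Classical in
/-- The modifications `d e` of `c`, `e ∈ B`, performed simultaneously. -/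
noncomputable def paste (c : G.edgeSet → Option (Fin n)) (B : Set G.edgeSet)
    (d : G.edgeSet → G.edgeSet → Option (Fin n)) (f : G.edgeSet) : Option (Fin n) :=
  if h : ∃ e ∈ B, d e f ≠ c f then d h.choose f else c f

variable {c : G.edgeSet → Option (Fin n)} {B : Set G.edgeSet}
  {d : G.edgeSet → G.edgeSet → Option (Fin n)}

theorem paste_of_forall {f : G.edgeSet} (h : ∀ e ∈ B, d e f = c f) : paste c B d f = c f := by
  rw [paste, dif_neg]
  push Not
  exact h

theorem paste_of_ne (hind : ∀ e ∈ B, ∀ e' ∈ B, e ≠ e' → ∀ f g, d e f ≠ c f → d e' g ≠ c g →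
    ¬ Touch f g) {e f : G.edgeSet} (he : e ∈ B) (hf : d e f ≠ c f) : paste c B d f = d e f := by
  have h : ∃ e ∈ B, d e f ≠ c f := ⟨e, he, hf⟩
  rw [paste, dif_pos h]
  by_contra hne
  refine hind _ h.choose_spec.1 e he ?_ f f h.choose_spec.2 hf (touch_refl f)
  intro heq
  exact hne (by rw [heq])

/-- Near an edge changed by d e, the pasted coloring coincides with d e, as no other modification
touches that edge. Any clash of colors would thus already occur in a single d e or in c. -/
theorem isProper_paste (hc : IsProper c) (hprop : ∀ e ∈ B, IsProper (d e))
    (hind : ∀ e ∈ B, ∀ e' ∈ B, e ≠ e' → ∀ f g, d e f ≠ c f → d e' g ≠ c g → ¬ Touch f g) :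
    IsProper (paste c B d) := by
  have key : ∀ e ∈ B, ∀ f g, d e f ≠ c f → Touch f g → paste c B d g = d e g := by
    intro e he f g hf hfg
    by_cases hg : ∃ e' ∈ B, d e' g ≠ c g
    · obtain ⟨e', he', hg⟩ := hg
      by_cases hee : e = e'
      · subst hee
        exact paste_of_ne hind he hg
      · exact absurd hfg (hind e he e' he' hee f g hf hg)
    · push Not at hg
      rw [paste_of_forall hg, hg e he]
  intro f g hfg ht a hf hg
  by_cases h1 : ∃ e ∈ B, d e f ≠ c f
  · obtain ⟨e, he, h1⟩ := h1
    rw [key e he f f h1 (touch_refl f)] at hf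
    rw [key e he f g h1 ht] at hg
    exact hprop e he f g hfg ht a hf hg
  by_cases h2 : ∃ e ∈ B, d e g ≠ c g
  · obtain ⟨e, he, h2⟩ := h2
    rw [key e he g f h2 (Touch.symm ht)] at hf
    rw [key e he g g h2 (touch_refl g)] at hg
    exact hprop e he f g hfg ht a hf hg
  push Not at h1 h2
  rw [paste_of_forall h1] at hf
  rw [paste_of_forall h2] at hg
  exact hc f g hfg ht a hf hg

variable [MeasurableSpace V]

/-- The element of B responsible for a change at f lies in the component of f, so it is some φ k f
and a countable union over k suffices. -/
theorem measurableSet_paste {φ : ℕ → G.edgeSet → G.edgeSet}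
    (hφ : IsComponentEnumeration G.lineGraph φ) (hc : IsPartialColoring c) (hB : MeasurableSet B)
    (hd : ∀ a, MeasurableSet {p : G.edgeSet × G.edgeSet | d p.1 p.2 = a})
    (hS : MeasurableSet {p : G.edgeSet × G.edgeSet | d p.1 p.2 ≠ c p.2})
    (hsupp : ∀ e ∈ B, ∀ f, d e f ≠ c f → G.lineGraph.Reachable e f)
    (hind : ∀ e ∈ B, ∀ e' ∈ B, e ≠ e' → ∀ f g, d e f ≠ c f → d e' g ≠ c g → ¬ Touch f g)
    (a : Fin n) : MeasurableSet {f | paste c B d f = some a} := by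
  let M : ℕ → Set G.edgeSet := fun k => {f | φ k f ∈ B ∧ d (φ k f) f ≠ c f}
  have hswap : ∀ k, Measurable fun f => (φ k f, f) := fun k => (hφ.measurable k).prodMk measurable_id
  have hM : ∀ k, MeasurableSet (M k) := fun k => (hφ.measurable k hB).inter (hswap k hS)
  have hMiff : ∀ f, (∃ e ∈ B, d e f ≠ c f) ↔ ∃ k, f ∈ M k := by
    intro f
    constructor
    · rintro ⟨e, he, hf⟩
      obtain ⟨k, rfl⟩ := (hφ.reachable_iff _ _).1 (hsupp e he f hf).symm
      exact ⟨k, he, hf⟩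
    · rintro ⟨k, hk1, hk2⟩
      exact ⟨_, hk1, hk2⟩
  have : {f | paste c B d f = some a} =
      (⋃ k, M k ∩ {f | d (φ k f) f = some a}) ∪ ((⋃ k, M k)ᶜ ∩ {f | c f = some a}) := by
    ext f
    by_cases h : ∃ k, f ∈ M k
    · have h' := h
      obtain ⟨k, hk⟩ := h'
      have hU : f ∈ ⋃ k, M k := Set.mem_iUnion.2 h
      simp only [Set.mem_ofPred_eq, Set.mem_union, Set.mem_inter_iff, Set.mem_compl_iff, hU,
        not_true, false_and, or_false, Set.mem_iUnion]
      constructor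
      · intro hf
        exact ⟨k, hk, by rwa [paste_of_ne hind hk.1 hk.2] at hf⟩
      · rintro ⟨j, hj, hf⟩
        rwa [paste_of_ne hind hj.1 hj.2]
    · have hU : f ∉ ⋃ k, M k := fun hU => h (Set.mem_iUnion.1 hU)
      have h' := h
      rw [← hMiff] at h'
      push Not at h' h
      simp [paste_of_forall h', h]
  rw [this]
  exact (MeasurableSet.iUnion fun k => (hM k).inter (hswap k (hd (some a)))).union
    ((MeasurableSet.iUnion hM).compl.inter (hc.measurableSet_color a))

theorem measurableSet_support (hc : IsPartialColoring c)
    (hd : ∀ a, MeasurableSet {p : G.edgeSet × G.edgeSet | d p.1 p.2 = a}) :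
    MeasurableSet {p : G.edgeSet × G.edgeSet | d p.1 p.2 ≠ c p.2} := by
  have : {p : G.edgeSet × G.edgeSet | d p.1 p.2 ≠ c p.2} =
      ⋃ a, {p | d p.1 p.2 = a} ∩ {p | c p.2 = a}ᶜ := by
    ext p
    simp only [Set.mem_ofPred_eq, Set.mem_iUnion, Set.mem_inter_iff, Set.mem_compl_iff,
      exists_eq_left']
    exact ne_comm
  rw [this]
  exact MeasurableSet.iUnion fun a => (hd a).inter (measurable_snd (hc.measurableSet_fiber a)).compl

/-- Simultaneous augmentation along pairwise independent modifications. -/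
theorem exists_improvement_of_independent [StandardBorelSpace G.edgeSet] {ν : Measure G.edgeSet} {φ : ℕ → G.edgeSet → G.edgeSet}
    (hφ : IsComponentEnumeration G.lineGraph φ) {ρ : G.edgeSet → G.edgeSet → ℝ}
    (hρ : IsRadonNikodymCocycle G.lineGraph ν ρ) {L : ℕ} (hc : IsPartialColoring c)
    (hB : MeasurableSet B) (hBc : B ⊆ uncolored c)
    (hd : ∀ a, MeasurableSet {p : G.edgeSet × G.edgeSet | d p.1 p.2 = a})
    (hsupp : ∀ e ∈ B, ∀ f, d e f ≠ c f → G.lineGraph.Reachable e f)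
    (hprop : ∀ e ∈ B, IsProper (d e))
    (hdom : ∀ e ∈ B, ∀ f, c f ≠ none → d e f ≠ none)
    (hself : ∀ e ∈ B, d e e ≠ none)
    (hwt : ∀ e ∈ B, sumAlong φ ρ e {f | d e f ≠ c f} ≤ L)
    (hind : ∀ e ∈ B, ∀ e' ∈ B, e ≠ e' → ∀ f g, d e f ≠ c f → d e' g ≠ c g → ¬ Touch f g) :
    ∃ c', IsPartialColoring c' ∧ Improves ν L c c' ∧
      ν (uncolored c') + ν B ≤ ν (uncolored c) := by
  have hS := measurableSet_support hc hd
  have hp : IsPartialColoring (paste c B d) :=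
    ⟨measurableSet_paste hφ hc hB hd hS hsupp hind, isProper_paste hc.proper hprop hind⟩
  have hpdom : ∀ f, c f ≠ none → paste c B d f ≠ none := by
    intro f hf
    by_cases h : ∃ e ∈ B, d e f ≠ c f
    · obtain ⟨e, he, h⟩ := h
      rw [paste_of_ne hind he h]
      exact hdom e he f hf
    · push Not at h
      rwa [paste_of_forall h]
  have hpself : ∀ e ∈ B, paste c B d e ≠ none := by
    intro e he
    have hne : d e e ≠ c e := by
      rw [show c e = none from hBc he]
      exact hself e he
    rw [paste_of_ne hind he hne]
    exact hself e he
  have hU : ν (uncolored (paste c B d)) + ν B ≤ ν (uncolored c) := by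
    rw [← measure_union _ hB]
    · refine measure_mono (Set.union_subset (fun f hf => ?_) hBc)
      by_contra hcf
      exact hpdom f hcf hf
    · exact Set.disjoint_left.2 fun e he heB => hpself e heB he
  refine ⟨paste c B d, hp, ⟨?_, ?_⟩, hU⟩
  · rw [show {e | c e ≠ none ∧ paste c B d e = none} = ∅ from
      Set.eq_empty_iff_forall_notMem.2 fun e he => hpdom e he.1 he.2]
    exact measure_empty
  -- The changes cost at most L ν(B), and by `hU` the uncolored set shrinks by at least ν(B).
  · have hdiff : ν {e | c e ≠ paste c B d e} ≤ L * ν B := by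
      calc ν {e | c e ≠ paste c B d e} ≤ ν {f | ∃ e ∈ B, (e, f) ∈ {p | d p.1 p.2 ≠ c p.2}} := by
            refine measure_mono fun f hf => ?_
            by_contra hcon
            refine hf (paste_of_forall fun e he => ?_).symm
            by_contra hne
            exact hcon ⟨e, he, hne⟩
        _ ≤ ∫⁻ e in B, sumAlong φ ρ e {f | (e, f) ∈ {p | d p.1 p.2 ≠ c p.2}} ∂ν := by
            refine measure_biUnion_le_lintegral_sumAlong hφ hρ hS hB hsupp ?_
            intro e he e' he' f hf hf'
            by_contra hne
            exact hind e he e' he' hne f f hf hf' (touch_refl f)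
        _ ≤ ∫⁻ _ in B, L ∂ν := setLIntegral_mono' hB fun e he => hwt e he
        _ = L * ν B := by rw [setLIntegral_const]
    calc ν {e | c e ≠ paste c B d e} + L * ν (uncolored (paste c B d))
        ≤ L * ν B + L * ν (uncolored (paste c B d)) := by gcongr
      _ = L * (ν (uncolored (paste c B d)) + ν B) := by ring
      _ ≤ _ := by gcongr

end Paste

theorem measurable_eq_prop {X Z : Type*} [MeasurableSpace X] [StandardBorelSpace X]
    [MeasurableSpace Z] {h h' : Z → X}
    (hh : Measurable h) (hh' : Measurable h') : Measurable fun z => h z = h' z :=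
  measurableSet_setOfPred.1 (measurableSet_eq_fun hh hh')

/-! ### Two-colored components and their ends. -/

section Kempe

variable {V : Type*} {G : SimpleGraph V} {n : ℕ}

/-- The edges `e` and `f` share a vertex and are both colored `α` or `β`. -/
def Kempe (c : G.edgeSet → Option (Fin n)) (α β : Fin n) (e f : G.edgeSet) : Prop :=
  Touch e f ∧ (c e = some α ∨ c e = some β) ∧ (c f = some α ∨ c f = some β)

/-- The edges `e` and `f` are equal or in the same component of the edges colored `α` or `β`. -/
def KempeConn (c : G.edgeSet → Option (Fin n)) (α β : Fin n) : G.edgeSet → G.edgeSet → Prop :=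
  Relation.ReflTransGen (Kempe c α β)

/-- The edge `r` is colored `α` or `β` and touches at most one other such edge. -/
def IsKempeEnd (c : G.edgeSet → Option (Fin n)) (α β : Fin n) (r : G.edgeSet) : Prop :=
  (c r = some α ∨ c r = some β) ∧
    ∀ f g, f ≠ r → g ≠ r → Kempe c α β r f → Kempe c α β r g → f = g

/-- The edge `r` is the only end of its `α/β`-component. -/
def IsKempeRoot (c : G.edgeSet → Option (Fin n)) (α β : Fin n) (r : G.edgeSet) : Prop :=
  IsKempeEnd c α β r ∧ ∀ r', KempeConn c α β r r' → IsKempeEnd c α β r' → r' = r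

variable {c : G.edgeSet → Option (Fin n)} {α β : Fin n}

theorem Kempe.symm {e f : G.edgeSet} (h : Kempe c α β e f) : Kempe c α β f e :=
  ⟨h.1.symm, h.2.2, h.2.1⟩

theorem KempeConn.symm {e f : G.edgeSet} (h : KempeConn c α β e f) : KempeConn c α β f e := by
  induction h with
  | refl => exact Relation.ReflTransGen.refl
  | tail _ h ih => exact Relation.ReflTransGen.head h.symm ih

theorem KempeConn.trans {e f g : G.edgeSet} (h : KempeConn c α β e f) (h' : KempeConn c α β f g) :
    KempeConn c α β e g :=
  Relation.ReflTransGen.trans h h'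

theorem KempeConn.reachable {e f : G.edgeSet} (h : KempeConn c α β e f) :
    G.lineGraph.Reachable e f := by
  induction h with
  | refl => exact SimpleGraph.Reachable.refl e
  | tail _ h ih => exact ih.trans h.1.reachable

theorem IsKempeRoot.eq {r r' : G.edgeSet} (h : IsKempeRoot c α β r) (h' : IsKempeRoot c α β r')
    (hrr' : KempeConn c α β r r') : r = r' :=
  (h.2 r' hrr' h'.1).symm

variable [MeasurableSpace V]

theorem IsPartialColoring.measurable_eq_const {Z : Type*} [MeasurableSpace Z]
    (hc : IsPartialColoring c) (a : Option (Fin n)) {h : Z → G.edgeSet} (hh : Measurable h) :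
    Measurable fun z => c (h z) = a :=
  measurableSet_setOfPred.1 (hh (hc.measurableSet_fiber a))

variable [StandardBorelSpace V] {φ : ℕ → G.edgeSet → G.edgeSet}

theorem measurable_touch : Measurable fun p : G.edgeSet × G.edgeSet => Touch p.1 p.2 :=
  measurableSet_setOfPred.1 measurableSet_touch

theorem measurable_kempe (hc : IsPartialColoring c) :
    Measurable fun p : G.edgeSet × G.edgeSet => Kempe c α β p.1 p.2 :=
  measurable_touch.and (((hc.measurable_eq_const _ measurable_fst).or
    (hc.measurable_eq_const _ measurable_fst)).and ((hc.measurable_eq_const _ measurable_snd).or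
    (hc.measurable_eq_const _ measurable_snd)))

variable [StandardBorelSpace G.edgeSet]

/-- Connectedness is stratified by path length; every intermediate edge is some φ k e, so the
quantifiers are countable. -/
theorem measurable_kempeConn (hφ : IsComponentEnumeration G.lineGraph φ)
    (hc : IsPartialColoring c) :
    Measurable fun p : G.edgeSet × G.edgeSet => KempeConn c α β p.1 p.2 := by
  let C : ℕ → G.edgeSet → G.edgeSet → Prop := fun m => m.rec (fun e f => e = f)
    fun _ P e f => ∃ k, P e (φ k e) ∧ Kempe c α β (φ k e) f
  have hC : ∀ m, Measurable fun p : G.edgeSet × G.edgeSet => C m p.1 p.2 := by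
    intro m
    induction m with
    | zero => exact measurableSet_setOfPred.1 (measurableSet_eq_fun measurable_fst measurable_snd)
    | succ m ih =>
      refine Measurable.exists fun k => Measurable.and ?_ ?_
      · exact ih.comp (measurable_fst.prodMk ((hφ.measurable k).comp measurable_fst))
      · exact (measurable_kempe hc).comp
          (((hφ.measurable k).comp measurable_fst).prodMk measurable_snd)
  have hiff : ∀ e f, KempeConn c α β e f ↔ ∃ m, C m e f := by
    intro e f
    constructor
    · intro h
      induction h with
      | refl => exact ⟨0, rfl⟩
      | @tail g f hg h ih =>
        obtain ⟨m, hm⟩ := ih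
        obtain ⟨k, rfl⟩ := (hφ.reachable_iff _ _).1 (KempeConn.reachable hg)
        exact ⟨m + 1, k, hm, h⟩
    · rintro ⟨m, hm⟩
      induction m generalizing f with
      | zero =>
        obtain rfl : e = f := hm
        exact Relation.ReflTransGen.refl
      | succ m ih =>
        obtain ⟨k, hk, h⟩ := hm
        exact Relation.ReflTransGen.tail (ih _ hk) h
  simp only [hiff]
  exact Measurable.exists hC

theorem measurable_isKempeEnd (hφ : IsComponentEnumeration G.lineGraph φ)
    (hc : IsPartialColoring c) : Measurable fun r : G.edgeSet => IsKempeEnd c α β r := by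
  have hiff : ∀ r, IsKempeEnd c α β r ↔ (c r = some α ∨ c r = some β) ∧
      ∀ i j, ¬ φ i r = r → ¬ φ j r = r → Kempe c α β r (φ i r) → Kempe c α β r (φ j r) →
        φ i r = φ j r := by
    intro r
    refine and_congr_right fun _ => ⟨fun h i j => h _ _, fun h f g hf hg hrf hrg => ?_⟩
    obtain ⟨i, rfl⟩ := (hφ.reachable_iff _ _).1 hrf.1.reachable
    obtain ⟨j, rfl⟩ := (hφ.reachable_iff _ _).1 hrg.1.reachable
    exact h i j hf hg hrf hrg
  simp only [hiff]
  have hK : ∀ i, Measurable fun r => Kempe c α β r (φ i r) := fun i =>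
    (measurable_kempe hc).comp (measurable_id.prodMk (hφ.measurable i))
  have hE : ∀ i, Measurable fun r => ¬ φ i r = r := fun i =>
    (measurable_eq_prop (hφ.measurable i) measurable_id).not
  exact ((hc.measurable_eq_const _ measurable_id).or (hc.measurable_eq_const _ measurable_id)).and
    (Measurable.forall fun i => Measurable.forall fun j => (hE i).imp ((hE j).imp ((hK i).imp
      ((hK j).imp (measurable_eq_prop (hφ.measurable i) (hφ.measurable j))))))

theorem measurable_isKempeRoot (hφ : IsComponentEnumeration G.lineGraph φ)
    (hc : IsPartialColoring c) : Measurable fun r : G.edgeSet => IsKempeRoot c α β r := by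
  have hiff : ∀ r, IsKempeRoot c α β r ↔ IsKempeEnd c α β r ∧
      ∀ i, KempeConn c α β r (φ i r) → IsKempeEnd c α β (φ i r) → φ i r = r := by
    intro r
    refine and_congr_right fun _ => ⟨fun h i => h _, fun h r' hr => ?_⟩
    obtain ⟨i, rfl⟩ := (hφ.reachable_iff _ _).1 hr.reachable
    exact h i hr
  simp only [hiff]
  exact (measurable_isKempeEnd hφ hc).and (Measurable.forall fun i =>
    ((measurable_kempeConn hφ hc).comp (measurable_id.prodMk (hφ.measurable i))).imp
      (((measurable_isKempeEnd hφ hc).comp (hφ.measurable i)).imp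
        (measurable_eq_prop (hφ.measurable i) measurable_id)))

end Kempe

/-! ### Modifications given by countably many codes, and their conflicts. -/

section Modification

variable {V : Type*} {G : SimpleGraph V} {n : ℕ}

open Classical in
/-- Exchange the colors `α` and `β` on the `α/β`-component of the edge `φ k e`, where `s` is the
triple `(k, α, β)`; do nothing if `s` is `none`. -/
noncomputable def kempeSwap (φ : ℕ → G.edgeSet → G.edgeSet) (c : G.edgeSet → Option (Fin n))
    (s : Option (ℕ × Fin n × Fin n)) (e f : G.edgeSet) : Option (Fin n) :=
  s.elim (c f) fun q =>
    if KempeConn c q.2.1 q.2.2 (φ q.1 e) f then (c f).map (Equiv.swap q.2.1 q.2.2) else c f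

open Classical in
/-- A modification of the coloring `c` near `e`: after `kempeSwap`, the edge `φ k e` gets the color
`a` for each `(k, a)` in the list. -/
noncomputable def modify (φ : ℕ → G.edgeSet → G.edgeSet) (c : G.edgeSet → Option (Fin n))
    (s : Option (ℕ × Fin n × Fin n)) : List (ℕ × Fin n) → G.edgeSet → G.edgeSet → Option (Fin n)
  | [], e, f => kempeSwap φ c s e f
  | q :: l, e, f => if f = φ q.1 e then some q.2 else modify φ c s l e f

variable {φ : ℕ → G.edgeSet → G.edgeSet} {c : G.edgeSet → Option (Fin n)}
  {s : Option (ℕ × Fin n × Fin n)} {l : List (ℕ × Fin n)}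

theorem kempeSwap_ne_none {e f : G.edgeSet} (h : c f ≠ none) : kempeSwap φ c s e f ≠ none := by
  cases s with
  | none => exact h
  | some q =>
    simp only [kempeSwap, Option.elim_some]
    split_ifs
    · simpa using h
    · exact h

theorem modify_ne_none {e f : G.edgeSet} (h : c f ≠ none) : modify φ c s l e f ≠ none := by
  induction l with
  | nil => exact kempeSwap_ne_none h
  | cons q l ih =>
    simp only [modify]
    split_ifs
    · simp
    · exact ih

theorem modify_eq_or_mem (e f : G.edgeSet) :
    modify φ c s l e f = kempeSwap φ c s e f ∨ ∃ q ∈ l, f = φ q.1 e := by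
  induction l with
  | nil => exact Or.inl rfl
  | cons q l ih =>
    by_cases h : f = φ q.1 e
    · exact Or.inr ⟨q, List.mem_cons_self, h⟩
    · simp only [modify, if_neg h]
      refine ih.imp id ?_
      rintro ⟨q', hq', h'⟩
      exact ⟨q', List.mem_cons_of_mem _ hq', h'⟩

theorem modify_eq_of_forall {e : G.edgeSet} {g : G.edgeSet → Option (Fin n)}
    (hl : ∀ q ∈ l, g (φ q.1 e) = some q.2)
    (hg : ∀ f, (∀ q ∈ l, f ≠ φ q.1 e) → kempeSwap φ c s e f = g f) : modify φ c s l e = g := by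
  induction l generalizing g with
  | nil => exact funext fun f => hg f (by simp)
  | cons q l ih =>
    classical
    have hq := hl q List.mem_cons_self
    -- For the shorter list the target is altered at the edge named by q, unless the rest of the
    -- list names it too. Repeated entries are harmless because all of them prescribe the value of
    -- g.
    have key := ih (g := fun f => if f = φ q.1 e ∧ ∀ q' ∈ l, f ≠ φ q'.1 e then
      kempeSwap φ c s e f else g f) ?_ ?_
    · funext f
      simp only [modify]
      split_ifs with h
      · rw [h, hq]
      · rw [key]
        exact if_neg fun h' => h h'.1
    · intro q' hq'
      rw [if_neg fun h => h.2 q' hq' rfl]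
      exact hl q' (List.mem_cons_of_mem _ hq')
    · intro f hf
      split_ifs with h
      · rfl
      · refine hg f fun q' hq' heq => ?_
        rcases List.mem_cons.1 hq' with rfl | hq'
        · exact h ⟨heq, hf⟩
        · exact hf q' hq' heq

/-- The color of f has to be recorded: `KempeConn` is reflexive, so it does not by itself give an
edge colored with one of the two colors. -/
theorem modify_ne_cases {e f : G.edgeSet} (h : modify φ c s l e f ≠ c f) :
    (∃ q ∈ l, f = φ q.1 e) ∨ ∃ q ∈ s, KempeConn c q.2.1 q.2.2 (φ q.1 e) f ∧
      (c f = some q.2.1 ∨ c f = some q.2.2) := by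
  rcases modify_eq_or_mem (φ := φ) (c := c) (s := s) (l := l) e f with h' | h'
  · right
    rw [h'] at h
    cases s with
    | none => exact absurd rfl h
    | some q =>
      refine ⟨q, rfl, ?_⟩
      simp only [kempeSwap, Option.elim_some] at h
      split_ifs at h with hconn
      · refine ⟨hconn, ?_⟩
        by_contra hcon
        push Not at hcon
        refine h ?_
        cases hcf : c f with
        | none => rfl
        | some a =>
          rw [hcf] at hcon
          rw [Option.map_some, Equiv.swap_apply_of_ne_of_ne (fun h => hcon.1 (by rw [h]))
            (fun h => hcon.2 (by rw [h]))]
      · exact absurd rfl h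
  · exact Or.inl h'

/-- Outside the component of e nothing changes, so properness reduces to countably many tests, which
makes it a Borel condition on e. -/
theorem isProper_of_forall_iterate [MeasurableSpace V] {d : G.edgeSet → Option (Fin n)}
    {e : G.edgeSet} (hφ : IsComponentEnumeration G.lineGraph φ) (hc : IsProper c)
    (hd : ∀ f, d f ≠ c f → G.lineGraph.Reachable e f)
    (h : ∀ i j, ¬ φ i e = φ j e → Touch (φ i e) (φ j e) → ∀ a, d (φ i e) = some a →
      ¬ d (φ j e) = some a) : IsProper d := by
  intro f g hfg ht a hf hg
  by_cases hr : G.lineGraph.Reachable e f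
  · obtain ⟨i, rfl⟩ := (hφ.reachable_iff _ _).1 hr
    obtain ⟨j, rfl⟩ := (hφ.reachable_iff _ _).1 (hr.trans (Touch.reachable ht))
    exact h i j hfg ht a hf hg
  · have hr' : ¬ G.lineGraph.Reachable e g := fun h =>
      hr (h.trans (Touch.reachable (Touch.symm ht)))
    have h1 : d f = c f := by_contra fun h => hr (hd f h)
    have h2 : d g = c g := by_contra fun h => hr' (hd g h)
    rw [h1] at hf
    rw [h2] at hg
    exact hc f g hfg ht a hf hg

variable [MeasurableSpace V]

theorem reachable_of_modify_ne (hφ : IsComponentEnumeration G.lineGraph φ) {e f : G.edgeSet}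
    (h : modify φ c s l e f ≠ c f) : G.lineGraph.Reachable e f := by
  rcases modify_ne_cases h with ⟨q, -, rfl⟩ | ⟨q, -, hconn, -⟩
  · exact hφ.reachable _ _
  · exact (hφ.reachable _ _).trans hconn.reachable

/-- The modification given by `s` and `l` is an augmentation at `e` of weight at most `L`, and the
component on which colors are exchanged has exactly one end, the edge where it is entered. -/
structure IsGood (φ : ℕ → G.edgeSet → G.edgeSet) (c : G.edgeSet → Option (Fin n))
    (ρ : G.edgeSet → G.edgeSet → ℝ) (L : ℕ) (s : Option (ℕ × Fin n × Fin n))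
    (l : List (ℕ × Fin n)) (e : G.edgeSet) : Prop where
  uncolored : c e = none
  self : ¬ modify φ c s l e e = none
  proper : ∀ i j, ¬ φ i e = φ j e → Touch (φ i e) (φ j e) → ∀ a,
    modify φ c s l e (φ i e) = some a → ¬ modify φ c s l e (φ j e) = some a
  weight_le : sumAlong φ ρ e {f | modify φ c s l e f ≠ c f} ≤ L
  root : ∀ q ∈ s, IsKempeRoot c q.2.1 q.2.2 (φ q.1 e)

/-- The modification at `e'` touches the edges listed by `l` at `e`, or exchanges colors on the
same component as the one at `e`. -/
def Conflict (φ : ℕ → G.edgeSet → G.edgeSet) (c : G.edgeSet → Option (Fin n))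
    (s : Option (ℕ × Fin n × Fin n)) (l : List (ℕ × Fin n)) (e e' : G.edgeSet) : Prop :=
  (∃ q ∈ l, ∃ j, Touch (φ q.1 e) (φ j e) ∧ ¬ modify φ c s l e' (φ j e) = c (φ j e)) ∨
    ∃ q ∈ s, φ q.1 e = φ q.1 e'

variable {ρ : G.edgeSet → G.edgeSet → ℝ} {L : ℕ}

theorem conflict_of_mem (hφ : IsComponentEnumeration G.lineGraph φ) {e e' f g : G.edgeSet}
    (hf : ∃ q ∈ l, f = φ q.1 e) (hg : modify φ c s l e' g ≠ c g) (ht : Touch f g) :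
    Conflict φ c s l e e' := by
  obtain ⟨q, hq, rfl⟩ := hf
  obtain ⟨j, rfl⟩ := (hφ.reachable_iff e g).1 ((hφ.reachable _ _).trans ht.reachable)
  exact Or.inl ⟨q, hq, j, ht, hg⟩

/-- If neither changed edge is listed, both are colored with the two exchanged colors. As they
touch, they lie in one component, which has only one root. -/
theorem conflict_or_conflict (hφ : IsComponentEnumeration G.lineGraph φ) {e e' f g : G.edgeSet}
    (he : IsGood φ c ρ L s l e) (he' : IsGood φ c ρ L s l e') (hf : modify φ c s l e f ≠ c f)
    (hg : modify φ c s l e' g ≠ c g) (ht : Touch f g) :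
    Conflict φ c s l e e' ∨ Conflict φ c s l e' e := by
  rcases modify_ne_cases hf with h | ⟨q, hq, hqf, hcf⟩
  · exact Or.inl (conflict_of_mem hφ h hg ht)
  rcases modify_ne_cases hg with h | ⟨q', hq', hqg, hcg⟩
  · exact Or.inr (conflict_of_mem hφ h hf ht.symm)
  obtain rfl := Option.mem_unique hq hq'
  refine Or.inl (Or.inr ⟨q, hq, (he.root q hq).eq (he'.root q hq) ?_⟩)
  exact (Relation.ReflTransGen.tail hqf ⟨ht, hcf, hcg⟩).trans hqg.symm

/-- A given edge g is changed from only finitely many good edges: a listed change puts e' in a fiber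
of some φ k, and a swap reaching g determines the root φ k e' of its component. Only the finitely
many edges touching the list at e matter. This is why `Conflict` is one-sided: an infinite swapped
component may be touched by the lists of infinitely many edges. -/
theorem finite_conflict (hφ : IsComponentEnumeration G.lineGraph φ)
    (hfin : ∀ e : G.edgeSet, {f | Touch e f}.Finite) (e : G.edgeSet) :
    {e' | IsGood φ c ρ L s l e' ∧ Conflict φ c s l e e'}.Finite := by
  have h1 : ∀ g, {e' | IsGood φ c ρ L s l e' ∧ modify φ c s l e' g ≠ c g}.Finite := by
    intro g
    have hl : {e' | ∃ q ∈ l, g = φ q.1 e'}.Finite := by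
      have : {e' | ∃ q ∈ l, g = φ q.1 e'} = ⋃ q ∈ {q | q ∈ l}, {e' | φ q.1 e' = g} := by
        ext; simp [eq_comm]
      rw [this]
      exact (List.finite_toSet l).biUnion fun q _ => hφ.finite_fiber _ _
    have hs : {e' | IsGood φ c ρ L s l e' ∧
        ∃ q ∈ s, KempeConn c q.2.1 q.2.2 (φ q.1 e') g}.Finite := by
      rcases Set.eq_empty_or_nonempty {e' | IsGood φ c ρ L s l e' ∧
        ∃ q ∈ s, KempeConn c q.2.1 q.2.2 (φ q.1 e') g} with h | ⟨e₁, h1, q, hq, hconn⟩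
      · rw [h]
        exact Set.finite_empty
      · refine (hφ.finite_fiber q.1 (φ q.1 e₁)).subset ?_
        rintro e₂ ⟨h2, q', hq', hconn'⟩
        obtain rfl := Option.mem_unique hq hq'
        exact (h2.root q hq).eq (h1.root q hq) (hconn'.trans hconn.symm)
    refine (hl.union hs).subset ?_
    rintro e' ⟨hgood, hne⟩
    rcases modify_ne_cases hne with h | ⟨q, hq, h, -⟩
    · exact Or.inl h
    · exact Or.inr ⟨hgood, q, hq, h⟩
  have h2 : (⋃ q ∈ {q | q ∈ l}, ⋃ g ∈ {g | Touch (φ q.1 e) g},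
      {e' | IsGood φ c ρ L s l e' ∧ modify φ c s l e' g ≠ c g}).Finite :=
    (List.finite_toSet l).biUnion fun q _ => (hfin _).biUnion fun g _ => h1 g
  have h3 : {e' | ∃ q ∈ s, φ q.1 e = φ q.1 e'}.Finite := by
    cases s with
    | none => simp
    | some q =>
      refine (hφ.finite_fiber q.1 (φ q.1 e)).subset ?_
      rintro e' ⟨q', hq', h⟩
      obtain rfl := Option.mem_unique hq' rfl
      exact h.symm
  refine (h2.union h3).subset ?_
  rintro e' ⟨hgood, ⟨q, hq, j, ht, hne⟩ | h⟩
  · left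
    simp only [Set.mem_iUnion]
    exact ⟨q, hq, φ j e, ht, hgood, hne⟩
  · exact Or.inr h

theorem measurable_option_map {Z : Type*} [MeasurableSpace Z] {h : Z → Option (Fin n)}
    (hh : ∀ a, Measurable fun z => h z = a) (g : Option (Fin n) → Option (Fin n))
    (a : Option (Fin n)) : Measurable fun z => g (h z) = a := by
  have : ∀ z, g (h z) = a ↔ ∃ b, h z = b ∧ g b = a := by simp
  simp only [this]
  exact Measurable.exists fun b => (hh b).and measurable_const

variable [StandardBorelSpace V] [StandardBorelSpace G.edgeSet]

theorem measurable_kempeSwap (hφ : IsComponentEnumeration G.lineGraph φ)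
    (hc : IsPartialColoring c) (a : Option (Fin n)) :
    Measurable fun p : G.edgeSet × G.edgeSet => kempeSwap φ c s p.1 p.2 = a := by
  have hc' : ∀ a, Measurable fun p : G.edgeSet × G.edgeSet => c p.2 = a :=
    fun a => hc.measurable_eq_const a measurable_snd
  cases s with
  | none => exact hc' a
  | some q =>
    have hiff : ∀ p : G.edgeSet × G.edgeSet, kempeSwap φ c (some q) p.1 p.2 = a ↔
        (KempeConn c q.2.1 q.2.2 (φ q.1 p.1) p.2 ∧ (c p.2).map (Equiv.swap q.2.1 q.2.2) = a) ∨
        (¬ KempeConn c q.2.1 q.2.2 (φ q.1 p.1) p.2 ∧ c p.2 = a) := by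
      intro p
      simp only [kempeSwap, Option.elim_some]
      split_ifs with h <;> simp [h]
    simp only [hiff]
    have hK : Measurable fun p : G.edgeSet × G.edgeSet =>
        KempeConn c q.2.1 q.2.2 (φ q.1 p.1) p.2 :=
      (measurable_kempeConn hφ hc).comp
        (((hφ.measurable q.1).comp measurable_fst).prodMk measurable_snd)
    exact (hK.and (measurable_option_map hc' _ a)).or (hK.not.and (hc' a))

theorem measurable_modify (hφ : IsComponentEnumeration G.lineGraph φ)
    (hc : IsPartialColoring c) (a : Option (Fin n)) :
    Measurable fun p : G.edgeSet × G.edgeSet => modify φ c s l p.1 p.2 = a := by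
  induction l with
  | nil => exact measurable_kempeSwap hφ hc a
  | cons q l ih =>
    have hiff : ∀ p : G.edgeSet × G.edgeSet, modify φ c s (q :: l) p.1 p.2 = a ↔
        (p.2 = φ q.1 p.1 ∧ some q.2 = a) ∨ (¬ p.2 = φ q.1 p.1 ∧ modify φ c s l p.1 p.2 = a) := by
      intro p
      simp only [modify]
      split_ifs with h <;> simp [h]
    simp only [hiff]
    have hE : Measurable fun p : G.edgeSet × G.edgeSet => p.2 = φ q.1 p.1 :=
      measurable_eq_prop measurable_snd ((hφ.measurable q.1).comp measurable_fst)
    exact (hE.and measurable_const).or (hE.not.and ih)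

theorem measurable_modify_eq (hφ : IsComponentEnumeration G.lineGraph φ)
    (hc : IsPartialColoring c) :
    Measurable fun p : G.edgeSet × G.edgeSet => modify φ c s l p.1 p.2 = c p.2 := by
  have hiff : ∀ p : G.edgeSet × G.edgeSet, modify φ c s l p.1 p.2 = c p.2 ↔
      ∃ a, modify φ c s l p.1 p.2 = a ∧ c p.2 = a := by
    intro p
    simp only [exists_eq_left']
    exact eq_comm
  simp only [hiff]
  exact Measurable.exists fun a =>
    (measurable_modify hφ hc a).and (hc.measurable_eq_const a measurable_snd)

theorem measurable_isGood {ν : Measure G.edgeSet} (hφ : IsComponentEnumeration G.lineGraph φ)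
    (hρ : IsRadonNikodymCocycle G.lineGraph ν ρ) (hc : IsPartialColoring c) :
    Measurable fun e => IsGood φ c ρ L s l e := by
  have hiff : ∀ e, IsGood φ c ρ L s l e ↔ c e = none ∧ ¬ modify φ c s l e e = none ∧
      (∀ i j, ¬ φ i e = φ j e → Touch (φ i e) (φ j e) → ∀ a,
        modify φ c s l e (φ i e) = some a → ¬ modify φ c s l e (φ j e) = some a) ∧
      sumAlong φ ρ e {f | modify φ c s l e f ≠ c f} ≤ L ∧
      ∀ q, s = some q → IsKempeRoot c q.2.1 q.2.2 (φ q.1 e) := fun e =>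
    ⟨fun h => ⟨h.1, h.2, h.3, h.4, h.5⟩, fun h => ⟨h.1, h.2.1, h.2.2.1, h.2.2.2.1, h.2.2.2.2⟩⟩
  simp only [hiff]
  have hm : ∀ i a, Measurable fun e => modify φ c s l e (φ i e) = a := fun i a =>
    (measurable_modify hφ hc a).comp (measurable_id.prodMk (hφ.measurable i))
  have hS : MeasurableSet {p : G.edgeSet × G.edgeSet | modify φ c s l p.1 p.2 ≠ c p.2} :=
    measurableSet_setOfPred.2 (measurable_modify_eq hφ hc).not
  refine (hc.measurable_eq_const _ measurable_id).and (Measurable.and ?_ (Measurable.and ?_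
    (Measurable.and ?_ ?_)))
  · exact ((measurable_modify hφ hc none).comp (measurable_id.prodMk measurable_id)).not
  · exact Measurable.forall fun i => Measurable.forall fun j =>
      (measurable_eq_prop (hφ.measurable i) (hφ.measurable j)).not.imp
      ((measurable_touch.comp ((hφ.measurable i).prodMk (hφ.measurable j))).imp
      (Measurable.forall fun a => (hm i _).imp (hm j _).not))
  · exact measurableSet_setOfPred.1 (measurableSet_le (measurable_sumAlong hφ hρ hS) measurable_const)
  · exact Measurable.forall fun q => measurable_const.imp
      ((measurable_isKempeRoot hφ hc).comp (hφ.measurable q.1))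

theorem measurable_conflict (hφ : IsComponentEnumeration G.lineGraph φ)
    (hc : IsPartialColoring c) (k : ℕ) : Measurable fun e => Conflict φ c s l e (φ k e) := by
  unfold Conflict
  have hφk := hφ.measurable
  refine Measurable.or (Measurable.exists fun q => measurable_const.and
    (Measurable.exists fun j => Measurable.and ?_ (Measurable.not ?_)))
    (Measurable.exists fun q => measurable_const.and ?_)
  · exact measurable_touch.comp ((hφk q.1).prodMk (hφk j))
  · exact (measurable_modify_eq hφ hc).comp ((hφk k).prodMk (hφk j))
  · exact measurable_eq_prop (hφk q.1) ((hφk q.1).comp (hφk k))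

end Modification

/-! ### Separating points from finite sets. -/

section Separation

/-- A countable family of Borel sets separates points from finite sets. -/
theorem exists_separating_family (X : Type*) [MeasurableSpace X] [StandardBorelSpace X] :
    ∃ U : ℚ × ℚ → Set X, (∀ i, MeasurableSet (U i)) ∧
      ∀ (x : X) (F : Set X), F.Finite → x ∉ F → ∃ i, x ∈ U i ∧ ∀ y ∈ F, y ∉ U i := by
  refine ⟨fun i => embeddingReal X ⁻¹' Set.Ioo (i.1 : ℝ) i.2,
    fun i => measurable_embeddingReal X measurableSet_Ioo, fun x F hF hx => ?_⟩
  have hopen : IsOpen (embeddingReal X '' F)ᶜ := (hF.image _).isClosed.isOpen_compl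
  have hmem : embeddingReal X x ∈ (embeddingReal X '' F)ᶜ := by
    rintro ⟨y, hy, hyx⟩
    exact hx ((measurableEmbedding_embeddingReal X).injective hyx ▸ hy)
  obtain ⟨v, hv, hxv, hsub⟩ :=
    Real.isTopologicalBasis_Ioo_rat.exists_subset_of_mem_open hmem hopen
  simp only [Set.mem_iUnion, Set.mem_singleton_iff] at hv
  obtain ⟨a, b, -, rfl⟩ := hv
  exact ⟨(a, b), hxv, fun y hy hyv => hsub hyv ⟨y, hy, rfl⟩⟩

end Separation

/-! ### A non-null set of good edges allows an improvement. -/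

section Improvement

variable {V : Type*} [MeasurableSpace V] [StandardBorelSpace V] {G : SimpleGraph V} {n : ℕ}
  [StandardBorelSpace G.edgeSet] {φ : ℕ → G.edgeSet → G.edgeSet}
  {c : G.edgeSet → Option (Fin n)} {ρ : G.edgeSet → G.edgeSet → ℝ} {L : ℕ}

/-- If good modifications exist at a set of edges of positive measure, then the measure of the
uncolored edges can be decreased by an improvement. -/
theorem exists_improvement {ν : Measure G.edgeSet} [IsFiniteMeasure ν]
    (hφ : IsComponentEnumeration G.lineGraph φ)
    (hfin : ∀ e : G.edgeSet, {f | Touch e f}.Finite)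
    (hρ : IsRadonNikodymCocycle G.lineGraph ν ρ) (hc : IsPartialColoring c)
    (hpos : ν {e | ∃ s l, IsGood φ c ρ L s l e} ≠ 0) :
    ∃ c', IsPartialColoring c' ∧ Improves ν L c c' ∧ ν (uncolored c') < ν (uncolored c) := by
  obtain ⟨U, hU, hsep⟩ := exists_separating_family G.edgeSet
  -- The good edges in U i having no conflict with another good edge of U i. These sets cover all
  -- good edges because U i can be chosen to contain e and to avoid its finitely many conflicts.
  let B : Option (ℕ × Fin n × Fin n) → List (ℕ × Fin n) → ℚ × ℚ → Set G.edgeSet := fun s l i =>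
    {e | (IsGood φ c ρ L s l e ∧ e ∈ U i) ∧ ∀ k, (IsGood φ c ρ L s l (φ k e) ∧ φ k e ∈ U i) →
      ¬ φ k e = e → ¬ Conflict φ c s l e (φ k e)}
  have hB : ∀ s l i, MeasurableSet (B s l i) := by
    intro s l i
    have h1 : Measurable fun e => IsGood φ c ρ L s l e ∧ e ∈ U i :=
      (measurable_isGood hφ hρ hc).and (measurable_mem.2 (hU i))
    exact measurableSet_setOfPred.2 (h1.and (Measurable.forall fun k =>
      (h1.comp (hφ.measurable k)).imp ((measurable_eq_prop (hφ.measurable k) measurable_id).not.imp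
        (measurable_conflict hφ hc k).not)))
  have hcover : {e | ∃ s l, IsGood φ c ρ L s l e} ⊆ ⋃ s, ⋃ l, ⋃ i, B s l i := by
    rintro e ⟨s, l, he⟩
    obtain ⟨i, hi, hF⟩ := hsep e ({e' | IsGood φ c ρ L s l e' ∧ Conflict φ c s l e e'} \ {e})
      ((finite_conflict hφ hfin e).sdiff) (fun h => h.2 rfl)
    simp only [Set.mem_iUnion]
    exact ⟨s, l, i, ⟨he, hi⟩, fun k hk hne hconf => hF _ ⟨⟨hk.1, hconf⟩, hne⟩ hk.2⟩
  -- There are only countably many codes (s, l) and indices i.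
  have hex : ∃ s l i, ν (B s l i) ≠ 0 := by
    by_contra hcon
    push Not at hcon
    exact hpos (measure_mono_null hcover (measure_iUnion_null fun s => measure_iUnion_null fun l =>
      measure_iUnion_null fun i => hcon s l i))
  obtain ⟨s, l, i, hν⟩ := hex
  have hnc : ∀ e ∈ B s l i, ∀ e' ∈ B s l i, e ≠ e' → G.lineGraph.Reachable e e' →
      ¬ Conflict φ c s l e e' := by
    intro e he e' he' hne hr
    obtain ⟨k, rfl⟩ := (hφ.reachable_iff _ _).1 hr
    exact he.2 k he'.1 hne.symm
  obtain ⟨c', hc', himp, hle⟩ := exists_improvement_of_independent (d := modify φ c s l) (L := L)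
    hφ hρ hc (hB s l i)
    (fun e he => he.1.1.uncolored)
    (fun a => measurableSet_setOfPred.2 (measurable_modify hφ hc a))
    (fun e _ f => reachable_of_modify_ne hφ)
    (fun e he => isProper_of_forall_iterate hφ hc.proper (fun f => reachable_of_modify_ne hφ)
      he.1.1.proper)
    (fun e _ f => modify_ne_none)
    (fun e he => he.1.1.self)
    (fun e he => he.1.1.weight_le)
    (fun e he e' he' hne f g hf hg ht => by
      have hr : G.lineGraph.Reachable e e' := (reachable_of_modify_ne hφ hf).trans
        (ht.reachable.trans (reachable_of_modify_ne hφ hg).symm)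
      -- Membership in B excludes conflicts with the other edge from both sides.
      rcases conflict_or_conflict hφ he.1.1 he'.1.1 hf hg ht with h | h
      · exact hnc e he e' he' hne hr h
      · exact hnc e' he' e he hne.symm hr.symm h)
  refine ⟨c', hc', himp, lt_of_lt_of_le ?_ hle⟩
  exact ENNReal.lt_add_right (measure_ne_top _ _) hν

end Improvement

/-! ### Concatenation and tails of sequences. -/

section Seq

variable {α : Type*}

theorem get?_append_of_eq_some {F X : Stream'.Seq α} {i : ℕ} {a : α} (h : F.get? i = some a) :
    (F.append X).get? i = some a := by
  induction i generalizing F with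
  | zero =>
    cases F with
    | nil => simp at h
    | cons b F => simpa [Stream'.Seq.cons_append] using h
  | succ i ih =>
    cases F with
    | nil => simp at h
    | cons b F =>
      rw [Stream'.Seq.cons_append, Stream'.Seq.get?_cons_succ]
      exact ih (by simpa using h)

theorem append_of_infinite {F : Stream'.Seq α} (X : Stream'.Seq α) (h : ∀ i, F.get? i ≠ none) :
    F.append X = F := by
  refine Stream'.Seq.ext fun i => ?_
  obtain ⟨a, ha⟩ := Option.ne_none_iff_exists'.1 (h i)
  rw [ha, get?_append_of_eq_some ha]

/-- The sequence `X` is obtained from `W` by deleting finitely many first terms. -/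
def IsTail (X W : Stream'.Seq α) : Prop := ∃ m, ∀ i, W.get? (m + i) = X.get? i

theorem IsTail.infinite {X W : Stream'.Seq α} (h : IsTail X W) (hW : ∀ i, W.get? i ≠ none) :
    ∀ i, X.get? i ≠ none := by
  obtain ⟨m, hm⟩ := h
  exact fun i => hm i ▸ hW _

theorem isTail_append_of_get?_eq_none {F : Stream'.Seq α} (X : Stream'.Seq α) {i : ℕ}
    (h : F.get? i = none) : IsTail X (F.append X) := by
  induction i generalizing F with
  | zero =>
    rw [Stream'.Seq.get?_zero_eq_none] at h
    subst h
    exact ⟨0, by simp⟩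
  | succ i ih =>
    cases F with
    | nil => exact ⟨0, by simp⟩
    | cons b F =>
      obtain ⟨m, hm⟩ := ih (F := F) (by simpa using h)
      refine ⟨m + 1, fun j => ?_⟩
      rw [Stream'.Seq.cons_append, show m + 1 + j = m + j + 1 by omega,
        Stream'.Seq.get?_cons_succ, hm]

end Seq

/-! ### From augmenting chains to good modifications. -/

section Chain

variable {V : Type*} {G : SimpleGraph V} {n : ℕ} {c : G.edgeSet → Option (Fin n)}
  {W : EdgeSeq G}

theorem shift_of_get? (hW : EdgeInjective W) {i : ℕ} {f : G.edgeSet} (h : W.get? i = some f) :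
    shift c W f = (W.get? (i + 1)).bind c := by
  classical
  have hex : ∃ i, W.get? i = some f := ⟨i, h⟩
  have : Nat.find hex = i := hW _ _ f (Nat.find_spec hex) h
  rw [shift, dif_pos hex, this]

theorem shift_of_forall_ne {f : G.edgeSet} (h : ∀ i, W.get? i ≠ some f) : shift c W f = c f := by
  rw [shift, dif_neg]
  push Not
  exact h

theorem IsChain.reachable (hW : IsChain W) {e f : G.edgeSet} (h0 : W.get? 0 = some e) {i : ℕ}
    (h : W.get? i = some f) : G.lineGraph.Reachable e f := by
  induction i generalizing f with
  | zero =>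
    obtain rfl : e = f := Option.some_injective _ (h0.symm.trans h)
    exact SimpleGraph.Reachable.refl e
  | succ i ih =>
    obtain ⟨g, hg⟩ := W.ge_stable (Nat.le_succ i) h
    exact (ih hg).trans (Touch.reachable (hW i g f hg h))

/-- First indices k of different points of S go to different positions in W, so the sum is a subsum
of the weight. -/
theorem sumAlong_le_weight [MeasurableSpace V] {φ : ℕ → G.edgeSet → G.edgeSet}
    {ρ : G.edgeSet → G.edgeSet → ℝ} {e : G.edgeSet} {S : Set G.edgeSet}
    (hS : ∀ f ∈ S, ∃ i, W.get? i = some f) : sumAlong φ ρ e S ≤ weight ρ e W := by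
  classical
  let K : Set ℕ := {k | φ k e ∈ S ∧ ∀ j < k, φ j e ≠ φ k e}
  choose! idx hidx using hS
  let τ : K → ℕ := fun k => idx (φ k e)
  have hτ : ∀ k : K, W.get? (τ k) = some (φ k e) := fun k => hidx _ k.2.1
  have hinj : Function.Injective τ := by
    intro k k' h
    have heq : φ k e = φ k' e := Option.some_injective _ (by rw [← hτ k, ← hτ k', h])
    refine Subtype.ext (le_antisymm (not_lt.1 fun hlt => ?_) (not_lt.1 fun hlt => ?_))
    · exact k.2.2 _ hlt heq.symm
    · exact k'.2.2 _ hlt heq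
  calc sumAlong φ ρ e S = ∑' k, K.indicator (fun k => ENNReal.ofReal (ρ e (φ k e))) k := by
        refine tsum_congr fun k => ?_
        by_cases hk : k ∈ K
        · rw [Set.indicator_of_mem hk]
          exact if_pos hk
        · rw [Set.indicator_of_notMem hk]
          exact if_neg hk
    _ = ∑' k : K, ENNReal.ofReal (ρ e (φ k e)) := (tsum_subtype K _).symm
    _ = ∑' k : K, (W.get? (τ k)).elim 0 fun f => ENNReal.ofReal (ρ e f) := by
        simp only [hτ, Option.elim_some]
    _ ≤ weight ρ e W := ENNReal.tsum_comp_le_tsum_of_injective hinj _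

theorem exists_recoloring_list [MeasurableSpace V] {φ : ℕ → G.edgeSet → G.edgeSet}
    (hφ : IsComponentEnumeration G.lineGraph φ)
    {e : G.edgeSet} {S : Set G.edgeSet} (hS : S.Finite) {g : G.edgeSet → Option (Fin n)}
    (hg : ∀ f ∈ S, G.lineGraph.Reachable e f ∧ g f ≠ none) :
    ∃ l : List (ℕ × Fin n), (∀ q ∈ l, g (φ q.1 e) = some q.2) ∧ ∀ f ∈ S, ∃ q ∈ l, f = φ q.1 e := by
  have hex : ∀ f : S, ∃ q : ℕ × Fin n, φ q.1 e = f ∧ g f = some q.2 := by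
    rintro ⟨f, hf⟩
    obtain ⟨k, hk⟩ := (hφ.reachable_iff _ _).1 (hg f hf).1
    obtain ⟨a, ha⟩ := Option.ne_none_iff_exists'.1 (hg f hf).2
    exact ⟨(k, a), hk, ha⟩
  choose q hq1 hq2 using hex
  have := hS.fintype
  refine ⟨Finset.univ.toList.map q, ?_, fun f hf => ⟨q ⟨f, hf⟩, ?_, (hq1 ⟨f, hf⟩).symm⟩⟩
  · simp only [List.mem_map]
    rintro _ ⟨f, -, rfl⟩
    rw [hq1 f, hq2 f]
  · exact List.mem_map_of_mem (by simp)

/-- Passage from a concrete recoloring g to a code: g may differ from a pure swap only on a finite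
set S, and the list records g on S. -/
theorem exists_isGood [MeasurableSpace V] {φ : ℕ → G.edgeSet → G.edgeSet}
    (hφ : IsComponentEnumeration G.lineGraph φ) {ρ : G.edgeSet → G.edgeSet → ℝ} {L : ℕ}
    {e : G.edgeSet} {S : Set G.edgeSet} (hS : S.Finite) {g : G.edgeSet → Option (Fin n)}
    {s : Option (ℕ × Fin n × Fin n)} (hce : c e = none) (hge : g e ≠ none) (hg : IsProper g)
    (hgW : ∀ f, g f ≠ c f → ∃ i, W.get? i = some f) (hwt : weight ρ e W ≤ L)
    (hgS : ∀ f ∈ S, G.lineGraph.Reachable e f ∧ g f ≠ none)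
    (hgs : ∀ f ∉ S, kempeSwap φ c s e f = g f)
    (hroot : ∀ q ∈ s, IsKempeRoot c q.2.1 q.2.2 (φ q.1 e)) :
    ∃ l, IsGood φ c ρ L s l e := by
  obtain ⟨l, hl, hlS⟩ := exists_recoloring_list hφ hS hgS
  have hmod : modify φ c s l e = g := modify_eq_of_forall hl fun f hf =>
    hgs f fun hfS => let ⟨q, hq, h⟩ := hlS f hfS; hf q hq h
  refine ⟨l, hce, by rwa [hmod], ?_, ?_, hroot⟩
  · rw [hmod]
    exact fun i j hij ht a hi hj => hg _ _ hij ht a hi hj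
  · rw [hmod]
    exact (sumAlong_le_weight hgW).trans hwt

theorem finite_setOf_get? (W : EdgeSeq G) (m : ℕ) : {f | ∃ i < m, W.get? i = some f}.Finite := by
  have : {f | ∃ i < m, W.get? i = some f} ⊆ ⋃ i ∈ Set.Iio m, {f | W.get? i = some f} := by
    rintro f ⟨i, hi, hf⟩
    simp only [Set.mem_iUnion]
    exact ⟨i, hi, hf⟩
  refine ((Set.finite_Iio m).biUnion fun i _ => ?_).subset this
  refine Set.Subsingleton.finite fun f hf g hg => ?_
  exact Option.some_injective _ ((show W.get? i = some f from hf).symm.trans hg)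

/-- A finite augmenting chain gives a good modification. -/
theorem exists_isGood_of_finite [MeasurableSpace V] {φ : ℕ → G.edgeSet → G.edgeSet}
    (hφ : IsComponentEnumeration G.lineGraph φ) {ρ : G.edgeSet → G.edgeSet → ℝ} {L : ℕ}
    {e : G.edgeSet} (hW : IsAugmenting c W) (h0 : W.get? 0 = some e) (hce : c e = none)
    (hwt : weight ρ e W ≤ L) {N : ℕ} (hN : W.get? N = none) :
    ∃ s l, IsGood φ c ρ L s l e := by
  classical
  have hex : ∃ N, W.get? N = none := ⟨N, hN⟩
  obtain ⟨m, hm⟩ : ∃ m, Nat.find hex = m + 1 := by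
    refine Nat.exists_eq_succ_of_ne_zero fun h => ?_
    have := Nat.find_spec hex
    rw [h, h0] at this
    simp at this
  have hm1 : W.get? (m + 1) = none := hm ▸ Nat.find_spec hex
  have hlt : ∀ i, W.get? i ≠ none → i < m + 1 := fun i hi =>
    not_le.1 fun hle => hi (W.le_stable hle hm1)
  obtain ⟨f, hf⟩ := Option.ne_none_iff_exists'.1 (Nat.find_min hex (m := m) (by omega))
  obtain ⟨a, ha⟩ := hW.last m f hf hm1
  have hsh := hW.properShiftable.shiftable
  have hinj := hsh.injective
  -- After the shift only the last edge f of W lacks a color, and a is missing at both its vertices.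
  -- The whole chain goes into the list, so no swap is needed.
  let g := Function.update (shift c W) f (some a)
  have hgf : g f = some a := Function.update_self ..
  have hgne : ∀ x, x ≠ f → g x = shift c W x := fun x hx => Function.update_of_ne hx ..
  have hgW : ∀ i x, W.get? i = some x → g x ≠ none := by
    intro i x hx
    by_cases hxf : x = f
    · rw [hxf, hgf]
      simp
    · have him : i < m := by
        have h1 := hlt i (by simp [hx])
        refine lt_of_le_of_ne (by omega) fun h => hxf ?_
        rw [h, hf] at hx
        exact (Option.some_injective _ hx).symm
      obtain ⟨y, hy⟩ := W.ge_stable (Nat.succ_le_of_lt him) hf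
      rw [hgne x hxf, shift_of_get? hinj hx]
      rw [Nat.succ_eq_add_one] at hy
      rw [hy]
      exact hsh.tail_colored i y hy
  have hgoff : ∀ x, (∀ i, W.get? i ≠ some x) → g x = c x := by
    intro x hx
    rw [hgne x (fun h => hx m (h ▸ hf)), shift_of_forall_ne hx]
  have hmiss : ∀ x, x ≠ f → Touch f x → shift c W x ≠ some a := by
    rintro x - ⟨v, hv1, hv2⟩
    exact ha v hv1 x hv2
  refine ⟨none, exists_isGood hφ (W := W) (finite_setOf_get? W (m + 1)) (g := g) hce (hgW 0 e h0)
    ?_ ?_ hwt ?_ ?_ (by simp)⟩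
  · intro x y hxy ht b hx hy
    by_cases hxf : x = f
    · subst hxf
      rw [hgf] at hx
      rw [hgne y hxy.symm, ← hx] at hy
      exact hmiss y hxy.symm ht hy
    by_cases hyf : y = f
    · subst hyf
      rw [hgf] at hy
      rw [hgne x hxy, ← hy] at hx
      exact hmiss x hxy (Touch.symm ht) hx
    rw [hgne x hxf] at hx
    rw [hgne y hyf] at hy
    exact hW.properShiftable.proper x y hxy ht b hx hy
  · intro x hx
    by_contra hcon
    exact hx (hgoff x (by simpa using hcon))
  · rintro x ⟨i, -, hi⟩
    exact ⟨hsh.chain.reachable h0 hi, hgW i x hi⟩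
  · intro x hx
    refine (hgoff x fun i hi => hx ⟨i, hlt i (by simp [hi]), hi⟩).symm

/-- An infinite alternating path, given by its edges `p i`. -/
structure IsRay (c : G.edgeSet → Option (Fin n)) (z : V) (α β : Fin n) (p : ℕ → G.edgeSet) :
    Prop where
  ne : α ≠ β
  missing_start : β ∈ missing c z
  injective : Function.Injective p
  touch : ∀ i, Touch (p i) (p (i + 1))
  start : z ∈ (p 0).1
  leave : z ∉ (p 1).1
  color : ∀ i, c (p i) = some (if Even i then α else β)

section Ray

variable {z : V} {α β : Fin n} {p : ℕ → G.edgeSet}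

theorem IsProper.eq_of_mem (hc : IsProper c) {e f : G.edgeSet} {v : V} (he : v ∈ e.1)
    (hf : v ∈ f.1) (hcol : c e = c f) (hne : c e ≠ none) : e = f := by
  obtain ⟨a, ha⟩ := Option.ne_none_iff_exists'.1 hne
  by_contra hef
  exact hc e f hef ⟨v, he, hf⟩ a ha (hcol ▸ ha)

theorem IsRay.colored (hp : IsRay c z α β p) (i : ℕ) : c (p i) = some α ∨ c (p i) = some β := by
  rw [hp.color i]
  split_ifs
  exacts [Or.inl rfl, Or.inr rfl]

theorem IsRay.ne_none (hp : IsRay c z α β p) (i : ℕ) : c (p i) ≠ none := by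
  simp [hp.color i]

theorem IsRay.kempe_succ (hp : IsRay c z α β p) (i : ℕ) : Kempe c α β (p i) (p (i + 1)) :=
  ⟨hp.touch i, hp.colored i, hp.colored (i + 1)⟩

theorem IsRay.color_add_two (hp : IsRay c z α β p) (i : ℕ) : c (p (i + 2)) = c (p i) := by
  simp [hp.color, Nat.even_add]

theorem IsRay.color_other (hp : IsRay c z α β p) (i : ℕ) {a : Option (Fin n)}
    (ha : a = some α ∨ a = some β) : a = c (p i) ∨ a = c (p (i + 1)) := by
  by_cases h : Even i
  · simpa [hp.color, h, Nat.even_add_one] using ha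
  · simpa [hp.color, h, Nat.even_add_one] using ha.symm

/-- By properness a vertex has at most one edge of each color. At inner vertices the ray already
uses both colors, and at its start z the color β is missing, so no other edge colored α or β can
touch the ray. -/
theorem IsRay.kempe_cases (hc : IsProper c) (hp : IsRay c z α β p) {i : ℕ} {f : G.edgeSet}
    (h : Kempe c α β (p i) f) : f = p i ∨ f = p (i + 1) ∨ ∃ j, i = j + 1 ∧ f = p j := by
  obtain ⟨⟨v, hv, hvf⟩, -, hf⟩ := h
  rcases hp.color_other i hf with hf | hf
  · exact Or.inl (hc.eq_of_mem hvf hv hf (hf ▸ hp.ne_none i))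
  obtain ⟨w, hw, hw'⟩ := hp.touch i
  have hvw : v = w → f = p (i + 1) := by
    rintro rfl
    exact hc.eq_of_mem hvf hw' hf (hf ▸ hp.ne_none _)
  cases i with
  | zero =>
    refine Or.inr (Or.inl (hvw ?_))
    have hvz : v ≠ z := by
      rintro rfl
      refine hp.missing_start f hvf ?_
      rw [hf, hp.color]
      simp
    have hwz : w ≠ z := by
      rintro rfl
      exact hp.leave hw'
    have hpe := (Sym2.mem_and_mem_iff hwz).1 ⟨hw, hp.start⟩
    rw [hpe, Sym2.mem_iff] at hv
    exact hv.resolve_right hvz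
  | succ j =>
    obtain ⟨u, hu, hu'⟩ := hp.touch j
    have huw : u ≠ w := by
      rintro rfl
      have := hc.eq_of_mem hu hw' (hp.color_add_two j).symm (hp.ne_none j)
      exact absurd (hp.injective this) (by omega)
    have hpe := (Sym2.mem_and_mem_iff huw).1 ⟨hu', hw⟩
    rw [hpe, Sym2.mem_iff] at hv
    rcases hv with rfl | rfl
    · refine Or.inr (Or.inr ⟨j, rfl, hc.eq_of_mem hvf hu ?_ ?_⟩)
      · rw [hf, hp.color_add_two]
      · rw [hf]
        exact hp.ne_none _
    · exact Or.inr (Or.inl (hvw rfl))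

theorem IsRay.kempeConn (hp : IsRay c z α β p) (i : ℕ) : KempeConn c α β (p 0) (p i) := by
  induction i with
  | zero => exact Relation.ReflTransGen.refl
  | succ i ih => exact Relation.ReflTransGen.tail ih (hp.kempe_succ i)

theorem IsRay.exists_eq_of_kempeConn (hc : IsProper c) (hp : IsRay c z α β p) {f : G.edgeSet}
    (h : KempeConn c α β (p 0) f) : ∃ i, f = p i := by
  induction h with
  | refl => exact ⟨0, rfl⟩
  | tail _ h ih =>
    obtain ⟨i, rfl⟩ := ih
    rcases hp.kempe_cases hc h with h | h | ⟨j, -, h⟩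
    exacts [⟨_, h⟩, ⟨_, h⟩, ⟨_, h⟩]

/-- The ray is its entire component; p 0 touches only p 1 there, while each p (i + 1) has the two
distinct neighbors p i and p (i + 2). -/
theorem IsRay.isKempeRoot (hc : IsProper c) (hp : IsRay c z α β p) :
    IsKempeRoot c α β (p 0) := by
  refine ⟨⟨hp.colored 0, fun f g hf hg hpf hpg => ?_⟩, fun r' hr' hend => ?_⟩
  · have key : ∀ f, f ≠ p 0 → Kempe c α β (p 0) f → f = p 1 := by
      intro f hf hpf
      rcases hp.kempe_cases hc hpf with h | h | ⟨j, h, -⟩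
      · exact absurd h hf
      · exact h
      · omega
    rw [key f hf hpf, key g hg hpg]
  · obtain ⟨i, rfl⟩ := hp.exists_eq_of_kempeConn hc hr'
    cases i with
    | zero => rfl
    | succ i =>
      have := hend.2 (p i) (p (i + 2)) (fun h => absurd (hp.injective h) (by omega))
        (fun h => absurd (hp.injective h) (by omega)) (hp.kempe_succ i).symm (hp.kempe_succ (i + 1))
      exact absurd (hp.injective this) (by omega)

theorem IsRay.map_swap (hp : IsRay c z α β p) (i : ℕ) :
    (c (p i)).map (Equiv.swap α β) = c (p (i + 1)) := by
  by_cases h : Even i <;> simp [hp.color, h, Nat.even_add_one]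

theorem exists_isRay {P : EdgeSeq G} (hαβ : α ≠ β) (hβ : β ∈ missing c z)
    (hP : IsAlternating c z α β P) (hinf : ∀ i, P.get? i ≠ none) :
    ∃ p : ℕ → G.edgeSet, IsRay c z α β p ∧ ∀ i, P.get? i = some (p i) := by
  choose p hp using fun i => Option.ne_none_iff_exists'.1 (hinf i)
  refine ⟨p, ⟨hαβ, hβ, ?_, ?_, ?_, ?_, ?_⟩, hp⟩
  · intro i j hij
    exact hP.injective i j (p i) (hp i) (hij ▸ hp j)
  · exact fun i => hP.chain i _ _ (hp i) (hp (i + 1))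
  · exact hP.start _ (hp 0)
  · exact hP.leave _ (hp 1)
  · exact fun i => hP.color i _ (hp i)

end Ray

/-- A chain which ends with an infinite alternating path gives a good modification. -/
theorem exists_isGood_of_isRay [MeasurableSpace V] {φ : ℕ → G.edgeSet → G.edgeSet}
    (hφ : IsComponentEnumeration G.lineGraph φ) {ρ : G.edgeSet → G.edgeSet → ℝ} {L : ℕ}
    {e : G.edgeSet} (hc : IsProper c) (hW : IsAugmenting c W) (h0 : W.get? 0 = some e)
    (hce : c e = none) (hwt : weight ρ e W ≤ L) (hinf : ∀ i, W.get? i ≠ none) {z : V} {α β : Fin n}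
    {p : ℕ → G.edgeSet} (hp : IsRay c z α β p) {m : ℕ} (hm : ∀ i, W.get? (m + i) = some (p i)) :
    ∃ s l, IsGood φ c ρ L s l e := by
  have hsh := hW.properShiftable.shiftable
  have hinj := hsh.injective
  obtain ⟨k, hk⟩ := (hφ.reachable_iff _ _).1 (hsh.chain.reachable h0 (hm 0))
  have hgW : ∀ i x, W.get? i = some x → shift c W x ≠ none := by
    intro i x hx
    obtain ⟨y, hy⟩ := Option.ne_none_iff_exists'.1 (hinf (i + 1))
    rw [shift_of_get? hinj hx, hy]
    exact hsh.tail_colored i y hy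
  refine ⟨some (k, α, β), exists_isGood hφ (W := W) (finite_setOf_get? W m) (g := shift c W) hce
    (hgW 0 e h0) hW.properShiftable.proper ?_ hwt ?_ ?_ ?_⟩
  · intro x hx
    by_contra hcon
    exact hx (shift_of_forall_ne (by simpa using hcon))
  · rintro x ⟨i, -, hi⟩
    exact ⟨hsh.chain.reachable h0 hi, hgW i x hi⟩
  · intro x hx
    simp only [kempeSwap, Option.elim_some]
    split_ifs with hconn <;> rw [hk] at hconn
    -- On the ray, taking the color of the next edge is the same as exchanging α and β.
    · obtain ⟨i, rfl⟩ := hp.exists_eq_of_kempeConn hc hconn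
      rw [hp.map_swap, shift_of_get? hinj (hm i), add_assoc, hm, Option.bind_some]
    · refine (shift_of_forall_ne fun i hi => ?_).symm
      have him : m ≤ i := not_lt.1 fun hlt => hx ⟨i, hlt, hi⟩
      obtain ⟨j, rfl⟩ := Nat.exists_eq_add_of_le him
      rw [hm] at hi
      exact hconn (Option.some_injective _ hi ▸ hp.kempeConn j)
  · rintro _ ⟨⟩
    rw [hk]
    exact hp.isKempeRoot hc

/-- A prefix of a fan is finite. -/
theorem not_infinite_of_isFan {y : V} {f : G.edgeSet} {A : Set (Fin n)} {F M : EdgeSeq G}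
    (hy : {f : G.edgeSet | y ∈ f.1}.Finite) (hM : IsFan c y f A M) (hF : IsPrefix F M) :
    ¬ ∀ i, F.get? i ≠ none := by
  intro hinf
  choose p hp using fun i => Option.ne_none_iff_exists'.1 (hinf i)
  refine Set.infinite_of_injective_forall_mem (f := p) (fun i j hij => ?_)
    (fun i => hM.center i _ (hF _ _ (hp i))) hy
  exact hM.injective i j (p i) (hF _ _ (hp i)) (hij ▸ hF _ _ (hp j))

theorem isTail_append_of_not_infinite {α : Type*} {F : Stream'.Seq α} (X : Stream'.Seq α)
    (h : ¬ ∀ i, F.get? i ≠ none) : IsTail X (F.append X) := by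
  push Not at h
  obtain ⟨i, hi⟩ := h
  exact isTail_append_of_get?_eq_none X hi

/-- The chain `W` ends with an infinite alternating path. -/
def EndsWithRay (c : G.edgeSet → Option (Fin n)) (W : EdgeSeq G) : Prop :=
  ∃ z α β p, IsRay c z α β p ∧ ∃ m, ∀ i, W.get? (m + i) = some (p i)

theorem EndsWithRay.of_isTail {X : EdgeSeq G} (h : EndsWithRay c X) (hX : IsTail X W) :
    EndsWithRay c W := by
  obtain ⟨z, α, β, p, hp, m, hm⟩ := h
  obtain ⟨k, hk⟩ := hX
  exact ⟨z, α, β, p, hp, k + m, fun i => by rw [add_assoc, hk, hm]⟩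

theorem ne_nil_of_infinite {α : Type*} {F : Stream'.Seq α} (h : ∀ i, F.get? i ≠ none) :
    F ≠ .nil := by
  rintro rfl
  exact h 0 rfl

theorem endsWithRay_of_alternatingPath {P : EdgeSeq G} {z : V} {α β : Fin n}
    (hP : P ≠ .nil → ∃ M, IsAlternatingPath c z α β M ∧ IsPrefix P M)
    (hinf : ∀ i, P.get? i ≠ none) : EndsWithRay c P := by
  obtain ⟨M, hM, hPM⟩ := hP (ne_nil_of_infinite hinf)
  obtain rfl : P = M := by
    refine Stream'.Seq.ext fun i => ?_
    obtain ⟨a, ha⟩ := Option.ne_none_iff_exists'.1 (hinf i)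
    rw [ha, hPM i a ha]
  obtain ⟨p, hp, hPp⟩ := exists_isRay hM.ne hM.missing_start hM.alternating hinf
  exact ⟨z, α, β, p, hp, 0, fun i => by rw [zero_add, hPp]⟩

theorem endsWithRay_append {P X : EdgeSeq G} {z : V} {α β : Fin n}
    (hP : P ≠ .nil → ∃ M, IsAlternatingPath c z α β M ∧ IsPrefix P M)
    (hinf : ∀ i, (P.append X).get? i ≠ none)
    (hX : (∀ i, X.get? i ≠ none) → EndsWithRay c X) : EndsWithRay c (P.append X) := by
  by_cases h : ∀ i, P.get? i ≠ none
  · rw [append_of_infinite X h]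
    exact endsWithRay_of_alternatingPath hP h
  · have ht := isTail_append_of_not_infinite X h
    exact (hX (ht.infinite hinf)).of_isTail ht

theorem endsWithRay_fan_append {F X : EdgeSeq G} (hF : ¬ ∀ i, F.get? i ≠ none)
    (hinf : ∀ i, (F.append X).get? i ≠ none)
    (hX : (∀ i, X.get? i ≠ none) → EndsWithRay c X) : EndsWithRay c (F.append X) :=
  have ht := isTail_append_of_not_infinite X hF
  (hX (ht.infinite hinf)).of_isTail ht

theorem not_infinite_of_conditionalFan {z y : V} {α β : Fin n} {F : EdgeSeq G}
    (hfin : ∀ y : V, {f : G.edgeSet | y ∈ f.1}.Finite)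
    (hF : F ≠ .nil → ∃ M, IsConditionalFan c z α β y M ∧ IsPrefix F M) :
    ¬ ∀ i, F.get? i ≠ none := by
  intro hinf
  obtain ⟨M, ⟨_, _, f, _, _, _, _, _, hM⟩, hFM⟩ := hF (ne_nil_of_infinite hinf)
  exact not_infinite_of_isFan (hfin y) hM.fan hFM hinf

/-- Prefixes of fans are finite, as their edges are distinct and share a vertex of finite degree. So
some alternating piece is infinite; everything after the first such piece is discarded by
concatenation. -/
theorem IsThreeStepVizingChain.endsWithRay {e : G.edgeSet}
    (hfin : ∀ y : V, {f : G.edgeSet | y ∈ f.1}.Finite) (hW : IsThreeStepVizingChain c e W)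
    (hinf : ∀ i, W.get? i ≠ none) : EndsWithRay c W := by
  obtain ⟨F₁, P₁, F₂, P₂, F₃, P₃, y₁, z₁, y₂, z₂, y₃, z₃, α₁, β₁, α₂, β₂, α₃, β₃, rfl, hF₁, hP₁,
    hF₂, hP₂, hF₃, hP₃, -, -⟩ := hW.decomposition
  have hF₁' : ¬ ∀ i, F₁.get? i ≠ none := fun h => by
    obtain ⟨-, M, hM, hFM⟩ := hF₁ (ne_nil_of_infinite h)
    exact not_infinite_of_isFan (hfin y₁) hM.fan hFM h
  exact endsWithRay_fan_append hF₁' hinf fun h => endsWithRay_append hP₁ h fun h =>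
    endsWithRay_fan_append (not_infinite_of_conditionalFan hfin hF₂) h fun h =>
    endsWithRay_append hP₂ h fun h =>
    endsWithRay_fan_append (not_infinite_of_conditionalFan hfin hF₃) h fun h =>
    endsWithRay_of_alternatingPath hP₃ h

theorem IsThreeStepVizingChain.get?_zero {e : G.edgeSet} (hW : IsThreeStepVizingChain c e W) :
    W.get? 0 = some e := by
  obtain ⟨f, hf, -⟩ := hW.augmenting.properShiftable.shiftable.head_uncolored
  obtain ⟨F₁, P₁, F₂, P₂, F₃, P₃, y₁, z₁, y₂, z₂, y₃, z₃, α₁, β₁, α₂, β₂, α₃, β₃, rfl, hF₁, -,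
    -, -, -, -, hnil, -⟩ := hW.decomposition
  have hne : F₁ ≠ .nil := by
    intro h
    have h1 : P₁ = .nil := hnil 0 1 (by decide) h
    have h2 : F₂ = .nil := hnil 0 2 (by decide) h
    have h3 : P₂ = .nil := hnil 0 3 (by decide) h
    have h4 : F₃ = .nil := hnil 0 4 (by decide) h
    have h5 : P₃ = .nil := hnil 0 5 (by decide) h
    subst h h1 h2 h3 h4 h5
    simp at hf
  obtain ⟨-, M, hM, hFM⟩ := hF₁ hne
  obtain ⟨x, hx⟩ := Option.ne_none_iff_exists'.1 fun h => hne (Stream'.Seq.get?_zero_eq_none.1 h)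
  rw [get?_append_of_eq_some hx, ← hFM 0 x hx, hM.fan.head]

theorem IsThreeStepVizingChain.exists_isGood [MeasurableSpace V] {φ : ℕ → G.edgeSet → G.edgeSet}
    (hφ : IsComponentEnumeration G.lineGraph φ) {ρ : G.edgeSet → G.edgeSet → ℝ} {L : ℕ}
    {e : G.edgeSet} (hfin : ∀ y : V, {f : G.edgeSet | y ∈ f.1}.Finite) (hc : IsProper c)
    (hW : IsThreeStepVizingChain c e W) (hce : c e = none) (hwt : weight ρ e W ≤ L) :
    ∃ s l, IsGood φ c ρ L s l e := by
  by_cases hinf : ∀ i, W.get? i ≠ none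
  · obtain ⟨z, α, β, p, hp, m, hm⟩ := hW.endsWithRay hfin hinf
    exact exists_isGood_of_isRay hφ hc hW.augmenting hW.get?_zero hce hwt hinf hp hm
  · push Not at hinf
    obtain ⟨N, hN⟩ := hinf
    exact exists_isGood_of_finite hφ hW.augmenting hW.get?_zero hce hwt hN

end Chain

end BorelVizing

/-! ### The theorem. -/

open BorelVizing
theorem theorem4p2 {V : Type*} [MeasurableSpace V] [StandardBorelSpace V]
    (G : SimpleGraph V) (hG : MeasurableSet G.edgeSet)
    (Δ : ℕ) (hΔ : IsMaxDegree G Δ)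
    (ν : Measure G.edgeSet) [IsProbabilityMeasure ν] (hν : QuasiInvariant G.lineGraph ν)
    (ρ : G.edgeSet → G.edgeSet → ℝ) (hρ : IsRadonNikodymCocycle G.lineGraph ν ρ)
    (c : G.edgeSet → Option (Fin (Δ + 1))) (hc : IsPartialColoring c) (L : ℕ) :
    ∃ c' : G.edgeSet → Option (Fin (Δ + 1)),
      IsPartialColoring c' ∧
      NoImprovement ν ρ c' L ∧
      ν {e | c e ≠ none ∧ c' e = none} = 0 ∧
      ν {e | c e ≠ c' e} ≤ L * ν (uncolored c) := by
  have := standardBorelSpace_edgeSet hG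
  obtain ⟨φ, hφ⟩ := exists_lineGraph_componentEnumeration hG hΔ
  obtain ⟨c', hc', himp, hmax⟩ := exists_maximal_improvement (ν := ν) (L := L) hc
  refine ⟨c', hc', ?_, himp.dom, le_self_add.trans himp.diff⟩
  -- The set of edges with a light chain is enlarged to the good edges; were these non-null,
  -- ν(U_{c'}) could be lowered, against maximality.
  refine measure_mono_null (t := {e | ∃ s l, IsGood φ c' ρ L s l e}) ?_ ?_
  · rintro e ⟨he, W, hW, hwt⟩
    exact hW.exists_isGood hφ (fun y => Set.finite_of_encard_le_coe (encard_incident_le hΔ y))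
      hc'.proper he hwt
  · by_contra hpos
    obtain ⟨c'', hc'', himp'', hlt⟩ := exists_improvement hφ (finite_touch hΔ) hρ hc' hpos
    exact absurd (hmax c'' hc'' himp'') (not_le.2 hlt)
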